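/- **Syntax.** Kinds are generated by $*$ and $\kappa_1\Rightarrow\kappa_2$. Interpretation types are the types of System $\mathtt F_\omega$ over the single type constant $\mathtt{nat}:*$: type constructors are variables (of each kind), $\mathtt{nat}$, applications $\varphi\psi$, abstractions $\lambda\alpha{:}\kappa.\varphi$, quantifications $\forall\alpha{:}\kappa.\sigma$ and arrows $\sigma\to\tau$ (up to renaming of bound variables); types are type constructors of kind $*$; $\mathrm{nf}_\beta$ denotes the $\beta$-normal form. Put $\chi_*=\mathtt{nat}$ and $\chi_{\kappa_1\Rightarrow\kappa_2}=\lambda\alpha{:}\kappa_1.\chi_{\kappa_2}$. The set $\mathcal I$ of interpretation terms consists of the typable Church-style $\mathtt F_\omega$-terms (variables of fixed types, $\lambda x{:}\sigma.s$, $\Lambda\alpha{:}\kappa.s$, $s\cdot t$, $s*\tau$), taken modulo $\beta$-conversion in types, over the constants $n:\mathtt{nat}$ ($n\in\mathbb N$), $\oplus,\otimes:\forall\alpha.\alpha\to\alpha\to\alpha$, $\mathtt{flatten}:\forall\alpha.\alpha\to\mathtt{nat}$ and $\mathtt{lift}:\forall\alpha.\mathtt{nat}\to\alpha$. $\mathcal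 I_\sigma$ is the set of interpretation terms of type $\sigma$. **Reduction.** $\leadsto$ is the closure, under all term formers, of $\beta$-reduction $(\lambda x{:}\sigma.s)\cdot t\leadsto s[x:=t]$, $(\Lambda\alpha.s)*\sigma\leadsto s[\alpha:=\sigma]$ and the rules ($\circ\in\{\oplus,\otimes\}$) - $\oplus_{\mathtt{nat}}\,n\,m\leadsto n+m$, $\ \otimes_{\mathtt{nat}}\,n\,m\leadsto n\times m$; - $\circ_{\sigma\to\tau}\,s\,t\leadsto\lambda x{:}\sigma.\circ_\tau(s\,x)(t\,x)$, $\ \circ_{\forall\alpha.\sigma}\,s\,t\leadsto\Lambda\alpha.\circ_\sigma(s\,\alpha)(t\,\alpha)$; - $\mathtt{flatten}_{\mathtt{nat}}\,s\leadsto s$, $\ \mathtt{flatten}_{\sigma\to\tau}\,s\leadsto\mathtt{flatten}_\tau(s\,(\mathtt{lift}_\sigma 0))$, $\ \mathtt{flatten}_{\forall\alpha:\kappa.\sigma}\,s\leadsto\mathtt{flatten}_{\sigma[\alpha:=\chi_\kappa]}(s\,\chi_\kappa)$; - $\mathtt{lift}_{\mathtt{nat}}\,s\leadsto s$, $\ \mathtt{lift}_{\sigma\to\tau}\,s\leadsto\lambda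 x{:}\sigma.\mathtt{lift}_\tau\,s$, $\ \mathtt{lift}_{\forall\alpha.\sigma}\,s\leadsto\Lambda\alpha.\mathtt{lift}_\sigma\,s$. $s{\downarrow}$ is the normal form of $s$ with respect to $\leadsto$, and $\mathcal I^f_\sigma$ is the set of closed terms of type $\sigma$ in normal form. **Ordering.** For $R\in\{\succ^0,\succeq^0\}$, closed $\beta$-normal $\sigma$ and closed $s,t\in\mathcal I_\sigma$, the relation $s\,R_\sigma\,t$ is defined coinductively (as the largest such relation) by the rules - $s\,R_{\mathtt{nat}}\,t$ if $s{\downarrow}$ and $t{\downarrow}$ are natural numbers with $s{\downarrow}>t{\downarrow}$ (resp. $s{\downarrow}\ge t{\downarrow}$); - $s\,R_{\sigma\to\tau}\,t$ if $s\cdot q\;R_\tau\;t\cdot q$ for all $q\in\mathcal I^f_\sigma$; - $s\,R_{\forall\alpha:\kappa.\sigma}\,t$ if $s*\tau\;R_{\mathrm{nf}_\beta(\sigma[\alpha:=\tau])}\;t*\tau$ for all closed type constructors $\tau$ of kind $\kappa$. A closure $\mathcal C$ substitutes a closed type constructor of the same kind for each type constructor variable, and for each term variable $x:\tau$ a closed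 term of type $\mathcal C(\tau)$. For an arbitrary type $\sigma$ and $s,t\in\mathcal I_\sigma$, $s\succ_\sigma t$ (resp. $s\succeq_\sigma t$) means that $\mathcal C(s)\succ^0_{\mathrm{nf}_\beta(\mathcal C(\sigma))}\mathcal C(t)$ (resp. with $\succeq^0$) for every closure $\mathcal C$. For $s,t\in\mathcal I$, $s\succ t$ (resp. $s\succeq t$) means $s\succ_\sigma t$ (resp. $s\succeq_\sigma t$) for some common type $\sigma$ of $s$ and $t$. **Theorem.** The following hold for $(\succ,\succeq)$ on $\mathcal I$, and for $(\succ_\sigma,\succeq_\sigma)$ on $\mathcal I_\sigma$ for every type $\sigma$: 1. $\succ$ is well-founded, i.e. there is no infinite sequence $t_1\succ t_2\succ t_3\succ\cdots$; 2. $\succ$ and $\succeq$ are transitive; 3. $\succeq$ is reflexive; 4. $\succ$ and $\succeq$ are compatible: $\succ\cdot\succeq\ \subseteq\ \succ$ and $\succeq\cdot\succ\ \subseteq\ \succ$; 5. $\succ\ \subseteq\ \succeq$. -/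

import Mathlib

namespace FOmega

/-! ### Kinds and type constructors

Bound variables are nameless, so syntax is automatically taken up to renaming of bound variables.
The variables that may occur free are a parameter: `V κ` is the set of type constructor variables
of kind `κ`. A type constructor is closed when it lives over the empty family `NoVar`. -/

inductive Kind : Type
  | star : Kind
  | arr : Kind → Kind → Kind

/-- The family `V` with one fresh variable `new` of kind `κ` added. -/
inductive Ext (V : Kind → Type) (κ : Kind) : Kind → Type
  | new : Ext V κ κ
  | old {κ' : Kind} : V κ' → Ext V κ κ'

/-- No type constructor variables at all. -/
abbrev NoVar : Kind → Type := fun _ => Empty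

/-- Type constructors over the single type constant `nat`, with free variables from `V`. -/
inductive TyCon : (Kind → Type) → Kind → Type 1
  | var {V : Kind → Type} {κ : Kind} : V κ → TyCon V κ
  | nat {V : Kind → Type} : TyCon V Kind.star
  | app {V : Kind → Type} {κ₁ κ₂ : Kind} :
      TyCon V (Kind.arr κ₁ κ₂) → TyCon V κ₁ → TyCon V κ₂
  | lam {V : Kind → Type} (κ₁ : Kind) {κ₂ : Kind} :
      TyCon (Ext V κ₁) κ₂ → TyCon V (Kind.arr κ₁ κ₂)
  | all {V : Kind → Type} (κ : Kind) : TyCon (Ext V κ) Kind.star → TyCon V Kind.star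
  | arrow {V : Kind → Type} : TyCon V Kind.star → TyCon V Kind.star → TyCon V Kind.star

/-- A renaming of variables, extended below a binder. -/
def upRen {V W : Kind → Type} {κ : Kind} (f : ∀ κ', V κ' → W κ') :
    ∀ κ', Ext V κ κ' → Ext W κ κ'
  | _, Ext.new => Ext.new
  | _, Ext.old x => Ext.old (f _ x)

namespace TyCon

def rename : {V W : Kind → Type} → {κ : Kind} → (∀ κ', V κ' → W κ') → TyCon V κ → TyCon W κ
  | _, _, _, f, var x => var (f _ x)
  | _, _, _, _, nat => nat
  | _, _, _, f, app s t => app (rename f s) (rename f t)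
  | _, _, _, f, lam κ s => lam κ (rename (upRen f) s)
  | _, _, _, f, all κ s => all κ (rename (upRen f) s)
  | _, _, _, f, arrow s t => arrow (rename f s) (rename f t)

/-- A substitution, extended below a binder. -/
def up {V W : Kind → Type} {κ : Kind} (θ : ∀ κ', V κ' → TyCon W κ') :
    ∀ κ', Ext V κ κ' → TyCon (Ext W κ) κ'
  | _, Ext.new => var Ext.new
  | _, Ext.old x => rename (fun _ y => Ext.old y) (θ _ x)

/-- Simultaneous capture-avoiding substitution. -/
def subst : {V W : Kind → Type} → {κ : Kind} → (∀ κ', V κ' → TyCon W κ') → TyCon V κ → TyCon W κ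
  | _, _, _, θ, var x => θ _ x
  | _, _, _, _, nat => nat
  | _, _, _, θ, app s t => app (subst θ s) (subst θ t)
  | _, _, _, θ, lam κ s => lam κ (subst (up θ) s)
  | _, _, _, θ, all κ s => all κ (subst (up θ) s)
  | _, _, _, θ, arrow s t => arrow (subst θ s) (subst θ t)

/-- The substitution that replaces the newest variable by `τ` and keeps the others. -/
def single {V : Kind → Type} {κ : Kind} (τ : TyCon V κ) : ∀ κ', Ext V κ κ' → TyCon V κ'
  | _, Ext.new => τ
  | _, Ext.old x => var x

/-- `σ.inst τ` is `σ[α := τ]` where `α` is the newest variable. -/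
def inst {V : Kind → Type} {κ κ' : Kind} (σ : TyCon (Ext V κ) κ') (τ : TyCon V κ) : TyCon V κ' :=
  subst (single τ) σ

/-- The closed type constructor `χ_κ`: `χ_* = nat` and `χ_{κ₁ ⇒ κ₂} = λ α : κ₁. χ_{κ₂}`. -/
def chi : {V : Kind → Type} → (κ : Kind) → TyCon V κ
  | _, Kind.star => nat
  | _, Kind.arr κ₁ κ₂ => lam κ₁ (chi κ₂)

/-- One step of `β`-reduction: the compatible closure of `(λα.φ)ψ → φ[α := ψ]`. -/
inductive Step : {V : Kind → Type} → {κ : Kind} → TyCon V κ → TyCon V κ → Prop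
  | beta {V : Kind → Type} {κ₁ κ₂ : Kind} (φ : TyCon (Ext V κ₁) κ₂) (ψ : TyCon V κ₁) :
      Step (app (lam κ₁ φ) ψ) (inst φ ψ)
  | app_left {V : Kind → Type} {κ₁ κ₂ : Kind} {s s' : TyCon V (Kind.arr κ₁ κ₂)}
      (t : TyCon V κ₁) : Step s s' → Step (app s t) (app s' t)
  | app_right {V : Kind → Type} {κ₁ κ₂ : Kind} (s : TyCon V (Kind.arr κ₁ κ₂))
      {t t' : TyCon V κ₁} : Step t t' → Step (app s t) (app s t')
  | lam {V : Kind → Type} {κ₁ κ₂ : Kind} {s s' : TyCon (Ext V κ₁) κ₂} :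
      Step s s' → Step (lam κ₁ s) (lam κ₁ s')
  | all {V : Kind → Type} {κ : Kind} {s s' : TyCon (Ext V κ) Kind.star} :
      Step s s' → Step (all κ s) (all κ s')
  | arrow_left {V : Kind → Type} {s s' : TyCon V Kind.star} (t : TyCon V Kind.star) :
      Step s s' → Step (arrow s t) (arrow s' t)
  | arrow_right {V : Kind → Type} (s : TyCon V Kind.star) {t t' : TyCon V Kind.star} :
      Step t t' → Step (arrow s t) (arrow s t')

def IsNormal {V : Kind → Type} {κ : Kind} (τ : TyCon V κ) : Prop := ∀ τ', ¬ Step τ τ'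

/-! Substitution lemmas, needed for substitution to respect `β`-equality. -/

theorem rename_rename : ∀ {V : Kind → Type} {κ : Kind} (t : TyCon V κ) {W U : Kind → Type}
    (f : ∀ κ', V κ' → W κ') (g : ∀ κ', W κ' → U κ'),
    rename g (rename f t) = rename (fun κ' x => g κ' (f κ' x)) t := by
  intro V κ t
  have key : ∀ {V W U : Kind → Type} {κ : Kind} (f : ∀ κ', V κ' → W κ') (g : ∀ κ', W κ' → U κ'),
      (fun κ' (x : Ext V κ κ') => upRen g κ' (upRen f κ' x))
        = upRen (fun κ' x => g κ' (f κ' x)) := by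
    intro V W U κ f g; funext κ' x; cases x <;> rfl
  induction t with
  | var x => intros; rfl
  | nat => intros; rfl
  | app s t ihs iht => intros; simp [rename, ihs, iht]
  | lam κ s ih => intros; simp [rename, ih, key]
  | all κ s ih => intros; simp [rename, ih, key]
  | arrow s t ihs iht => intros; simp [rename, ihs, iht]

theorem subst_rename : ∀ {V : Kind → Type} {κ : Kind} (t : TyCon V κ) {W U : Kind → Type}
    (f : ∀ κ', V κ' → W κ') (θ : ∀ κ', W κ' → TyCon U κ'),
    subst θ (rename f t) = subst (fun κ' x => θ κ' (f κ' x)) t := by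
  intro V κ t
  have key : ∀ {V W U : Kind → Type} {κ : Kind} (f : ∀ κ', V κ' → W κ')
      (θ : ∀ κ', W κ' → TyCon U κ'),
      (fun κ' (x : Ext V κ κ') => up θ κ' (upRen f κ' x))
        = up (fun κ' x => θ κ' (f κ' x)) := by
    intro V W U κ f g; funext κ' x; cases x <;> rfl
  induction t with
  | var x => intros; rfl
  | nat => intros; rfl
  | app s t ihs iht => intros; simp [rename, subst, ihs, iht]
  | lam κ s ih => intros; simp [rename, subst, ih, key]
  | all κ s ih => intros; simp [rename, subst, ih, key]
  | arrow s t ihs iht => intros; simp [rename, subst, ihs, iht]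

theorem rename_subst : ∀ {V : Kind → Type} {κ : Kind} (t : TyCon V κ) {W U : Kind → Type}
    (θ : ∀ κ', V κ' → TyCon W κ') (f : ∀ κ', W κ' → U κ'),
    rename f (subst θ t) = subst (fun κ' x => rename f (θ κ' x)) t := by
  intro V κ t
  have key : ∀ {V W U : Kind → Type} {κ : Kind} (θ : ∀ κ', V κ' → TyCon W κ')
      (f : ∀ κ', W κ' → U κ'),
      (fun κ' (x : Ext V κ κ') => rename (upRen f) (up θ κ' x))
        = up (fun κ' x => rename f (θ κ' x)) := by
    intro V W U κ θ f; funext κ' x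
    cases x with
    | new => rfl
    | old x => simp [up, rename_rename, upRen]
  induction t with
  | var x => intros; rfl
  | nat => intros; rfl
  | app s t ihs iht => intros; simp [rename, subst, ihs, iht]
  | lam κ s ih => intros; simp [rename, subst, ih, key]
  | all κ s ih => intros; simp [rename, subst, ih, key]
  | arrow s t ihs iht => intros; simp [rename, subst, ihs, iht]

theorem subst_subst : ∀ {V : Kind → Type} {κ : Kind} (t : TyCon V κ) {W U : Kind → Type}
    (θ : ∀ κ', V κ' → TyCon W κ') (η : ∀ κ', W κ' → TyCon U κ'),
    subst η (subst θ t) = subst (fun κ' x => subst η (θ κ' x)) t := by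
  intro V κ t
  have key : ∀ {V W U : Kind → Type} {κ : Kind} (θ : ∀ κ', V κ' → TyCon W κ')
      (η : ∀ κ', W κ' → TyCon U κ'),
      (fun κ' (x : Ext V κ κ') => subst (up η) (up θ κ' x))
        = up (fun κ' x => subst η (θ κ' x)) := by
    intro V W U κ θ η; funext κ' x
    cases x with
    | new => rfl
    | old x => simp [up, subst_rename, rename_subst]
  induction t with
  | var x => intros; rfl
  | nat => intros; rfl
  | app s t ihs iht => intros; simp [subst, ihs, iht]
  | lam κ s ih => intros; simp [subst, ih, key]
  | all κ s ih => intros; simp [subst, ih, key]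
  | arrow s t ihs iht => intros; simp [subst, ihs, iht]

theorem subst_var : ∀ {V : Kind → Type} {κ : Kind} (t : TyCon V κ),
    subst (fun _ x => var x) t = t := by
  intro V κ t
  have key : ∀ {V : Kind → Type} {κ : Kind},
      up (κ := κ) (fun κ' (x : V κ') => var x) = fun _ x => var x := by
    intro V κ; funext κ' x; cases x <;> rfl
  induction t with
  | var x => rfl
  | nat => rfl
  | app s t ihs iht => simp [subst, ihs, iht]
  | lam κ s ih => simp [subst, ih, key]
  | all κ s ih => simp [subst, ih, key]
  | arrow s t ihs iht => simp [subst, ihs, iht]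

theorem subst_inst {V W : Kind → Type} {κ κ' : Kind} (σ : TyCon (Ext V κ) κ') (τ : TyCon V κ)
    (θ : ∀ κ', V κ' → TyCon W κ') :
    subst θ (inst σ τ) = inst (subst (up θ) σ) (subst θ τ) := by
  unfold inst
  rw [subst_subst, subst_subst]
  congr 1
  funext κ'' x
  cases x with
  | new => rfl
  | old x => simp [up, single, subst, subst_rename, subst_var]

theorem Step.subst : ∀ {V : Kind → Type} {κ : Kind} {s t : TyCon V κ}, Step s t →
    ∀ {W : Kind → Type} (θ : ∀ κ', V κ' → TyCon W κ'), Step (subst θ s) (subst θ t) := by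
  intro V κ s t h
  induction h with
  | beta φ ψ => intro W θ; rw [subst_inst]; exact Step.beta _ _
  | app_left t _ ih => intro W θ; exact Step.app_left _ (ih θ)
  | app_right s _ ih => intro W θ; exact Step.app_right _ (ih θ)
  | lam _ ih => intro W θ; exact Step.lam (ih _)
  | all _ ih => intro W θ; exact Step.all (ih _)
  | arrow_left t _ ih => intro W θ; exact Step.arrow_left _ (ih θ)
  | arrow_right s _ ih => intro W θ; exact Step.arrow_right _ (ih θ)

/-- `β`-equality `=_β`. -/
def betaSetoid (V : Kind → Type) (κ : Kind) : Setoid (TyCon V κ) := Relation.EqvGen.setoid Step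

theorem eqvGen_map {α : Type*} {β : Type*} {r : α → α → Prop} {r' : β → β → Prop} (f : α → β)
    (h : ∀ a b, r a b → r' (f a) (f b)) {a b : α} (hab : Relation.EqvGen r a b) :
    Relation.EqvGen r' (f a) (f b) := by
  induction hab with
  | rel a b h' => exact .rel _ _ (h a b h')
  | refl a => exact .refl _
  | symm a b _ ih => exact .symm _ _ ih
  | trans a b c _ _ ih₁ ih₂ => exact .trans _ _ _ ih₁ ih₂

end TyCon

/-! ### Type constructors modulo `β` -/

/-- `=_β`-classes of type constructors. -/
def Ty (V : Kind → Type) (κ : Kind) : Type 1 := Quotient (TyCon.betaSetoid V κ)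

namespace Ty

def mk {V : Kind → Type} {κ : Kind} (τ : TyCon V κ) : Ty V κ := Quotient.mk _ τ

def nat {V : Kind → Type} : Ty V Kind.star := mk TyCon.nat

def arrow {V : Kind → Type} (σ τ : Ty V Kind.star) : Ty V Kind.star :=
  Quotient.map₂ TyCon.arrow
    (fun _ a₂ ha b₁ _ hb => Relation.EqvGen.trans _ (TyCon.arrow a₂ b₁) _
      (TyCon.eqvGen_map (fun a => TyCon.arrow a b₁) (fun _ _ h => .arrow_left _ h) ha)
      (TyCon.eqvGen_map (fun b => TyCon.arrow a₂ b) (fun _ _ h => .arrow_right _ h) hb)) σ τ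

def all {V : Kind → Type} (κ : Kind) (σ : Ty (Ext V κ) Kind.star) : Ty V Kind.star :=
  Quotient.map (TyCon.all κ)
    (fun _ _ h => TyCon.eqvGen_map (TyCon.all κ) (fun _ _ h => .all h) h) σ

def subst {V W : Kind → Type} {κ : Kind} (θ : ∀ κ', V κ' → TyCon W κ') (σ : Ty V κ) : Ty W κ :=
  Quotient.map (TyCon.subst θ)
    (fun _ _ h => TyCon.eqvGen_map (TyCon.subst θ) (fun _ _ h => h.subst θ) h) σ

/-- Weakening by one fresh variable of kind `κ`. -/
def weaken {V : Kind → Type} (κ : Kind) {κ' : Kind} (σ : Ty V κ') : Ty (Ext V κ) κ' :=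
  subst (fun _ x => TyCon.var (Ext.old x)) σ

/-- `σ.inst τ` is `σ[α := τ]` where `α` is the newest variable. -/
def inst {V : Kind → Type} {κ κ' : Kind} (σ : Ty (Ext V κ) κ') (τ : TyCon V κ) : Ty V κ' :=
  subst (TyCon.single τ) σ

open Classical in
/-- `nf_β`: the `β`-normal form, i.e. the `β`-normal member of the class. -/
noncomputable def nf {V : Kind → Type} {κ : Kind} (σ : Ty V κ) : TyCon V κ :=
  if h : ∃ τ : TyCon V κ, mk τ = σ ∧ τ.IsNormal then h.choose else Quotient.out σ

end Ty

/-! ### Interpretation terms -/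

/-- The function symbols: natural numbers, addition, multiplication, `flatten` and `lift`. -/
inductive Sym : Type
  | num : ℕ → Sym
  | plus : Sym
  | times : Sym
  | flatten : Sym
  | lift : Sym

/-- The (closed) declared type of a function symbol. -/
def Sym.type {V : Kind → Type} : Sym → TyCon V Kind.star
  | num _ => .nat
  | plus => .all .star (.arrow (.var .new) (.arrow (.var .new) (.var .new)))
  | times => .all .star (.arrow (.var .new) (.arrow (.var .new) (.var .new)))
  | flatten => .all .star (.arrow (.var .new) .nat)
  | lift => .all .star (.arrow .nat (.var .new))

/-- Raw terms with free type constructor variables from `V` and free term variables from `X`.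
The type constructors that occur in a term are `=_β`-classes; so an element of `Term V X` is an
expression modulo `β`-conversion in types (and modulo renaming of bound variables). -/
inductive Term : (Kind → Type) → Type → Type 1
  | var {V : Kind → Type} {X : Type} : X → Term V X
  | sym {V : Kind → Type} {X : Type} : Sym → Term V X
  | lam {V : Kind → Type} {X : Type} : Ty V Kind.star → Term V (Option X) → Term V X
  | app {V : Kind → Type} {X : Type} : Term V X → Term V X → Term V X
  | tlam {V : Kind → Type} {X : Type} (κ : Kind) : Term (Ext V κ) X → Term V X
  | tapp {V : Kind → Type} {X : Type} {κ : Kind} : Term V X → Ty V κ → Term V X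

/-- The typing environment `Γ` extended by a new variable `none` of type `σ`. -/
def extEnv {V : Kind → Type} {X : Type} (Γ : X → Ty V Kind.star) (σ : Ty V Kind.star) :
    Option X → Ty V Kind.star
  | none => σ
  | some x => Γ x

/-- `HasType Γ s σ` means `s : σ`, where each free variable `x` has the type `Γ x`. The conversion
rule is built in, because types are `=_β`-classes. In the rule for `Λ`, the new type constructor
variable does not occur in the types of the free variables, because these are weakened. -/
inductive HasType : {V : Kind → Type} → {X : Type} → (X → Ty V Kind.star) →
    Term V X → Ty V Kind.star → Prop
  | var {V : Kind → Type} {X : Type} {Γ : X → Ty V Kind.star} (x : X) :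
      HasType Γ (.var x) (Γ x)
  | sym {V : Kind → Type} {X : Type} {Γ : X → Ty V Kind.star} (f : Sym) :
      HasType Γ (.sym f) (Ty.mk f.type)
  | lam {V : Kind → Type} {X : Type} {Γ : X → Ty V Kind.star} {σ τ : Ty V Kind.star}
      {s : Term V (Option X)} :
      HasType (extEnv Γ σ) s τ → HasType Γ (.lam σ s) (Ty.arrow σ τ)
  | app {V : Kind → Type} {X : Type} {Γ : X → Ty V Kind.star} {σ τ : Ty V Kind.star}
      {s t : Term V X} :
      HasType Γ s (Ty.arrow σ τ) → HasType Γ t σ → HasType Γ (.app s t) τ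
  | tlam {V : Kind → Type} {X : Type} {Γ : X → Ty V Kind.star} {κ : Kind}
      {σ : Ty (Ext V κ) Kind.star} {s : Term (Ext V κ) X} :
      HasType (fun x => (Γ x).weaken κ) s σ → HasType Γ (.tlam κ s) (Ty.all κ σ)
  | tapp {V : Kind → Type} {X : Type} {Γ : X → Ty V Kind.star} {κ : Kind}
      {σ : Ty (Ext V κ) Kind.star} {s : Term V X} (τ : TyCon V κ) :
      HasType Γ s (Ty.all κ σ) → HasType Γ (.tapp s (Ty.mk τ)) (σ.inst τ)

namespace Term

/-- Renaming of term variables. -/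
def rename : {V : Kind → Type} → {X Y : Type} → (X → Y) → Term V X → Term V Y
  | _, _, _, f, var x => var (f x)
  | _, _, _, _, sym c => sym c
  | _, _, _, f, lam σ s => lam σ (rename (Option.map f) s)
  | _, _, _, f, app s t => app (rename f s) (rename f t)
  | _, _, _, f, tlam κ s => tlam κ (rename f s)
  | _, _, _, f, tapp s τ => tapp (rename f s) τ

/-- Substitution of type constructors in terms. -/
def tsubst : {V W : Kind → Type} → {X : Type} → (∀ κ, V κ → TyCon W κ) → Term V X → Term W X
  | _, _, _, _, var x => var x
  | _, _, _, _, sym c => sym c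
  | _, _, _, θ, lam σ s => lam (σ.subst θ) (tsubst θ s)
  | _, _, _, θ, app s t => app (tsubst θ s) (tsubst θ t)
  | _, _, _, θ, tlam κ s => tlam κ (tsubst (TyCon.up θ) s)
  | _, _, _, θ, tapp s τ => tapp (tsubst θ s) (τ.subst θ)

/-- Weakening by a new term variable. -/
def weaken {V : Kind → Type} {X : Type} (s : Term V X) : Term V (Option X) := rename some s

/-- Weakening by a new type constructor variable. -/
def tweaken {V : Kind → Type} {X : Type} (κ : Kind) (s : Term V X) : Term (Ext V κ) X :=
  tsubst (fun _ x => TyCon.var (Ext.old x)) s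

/-- A term substitution, extended below a `λ`. -/
def up {V : Kind → Type} {X Y : Type} (γ : X → Term V Y) : Option X → Term V (Option Y)
  | none => var none
  | some x => (γ x).weaken

/-- Simultaneous capture-avoiding substitution of terms for term variables. -/
def subst : {V : Kind → Type} → {X Y : Type} → (X → Term V Y) → Term V X → Term V Y
  | _, _, _, γ, var x => γ x
  | _, _, _, _, sym c => sym c
  | _, _, _, γ, lam σ s => lam σ (subst (up γ) s)
  | _, _, _, γ, app s t => app (subst γ s) (subst γ t)
  | _, _, _, γ, tlam κ s => tlam κ (subst (fun x => (γ x).tweaken κ) s)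
  | _, _, _, γ, tapp s τ => tapp (subst γ s) τ

/-- `s.inst t` is `s[x := t]` where `x` is the newest term variable. -/
def inst {V : Kind → Type} {X : Type} (s : Term V (Option X)) (t : Term V X) : Term V X :=
  subst (fun o => o.elim t var) s

/-- `s.tinst τ` is `s[α := τ]` where `α` is the newest type constructor variable. -/
def tinst {V : Kind → Type} {X : Type} {κ : Kind} (s : Term (Ext V κ) X) (τ : TyCon V κ) :
    Term V X :=
  tsubst (TyCon.single τ) s

def num {V : Kind → Type} {X : Type} (n : ℕ) : Term V X := sym (Sym.num n)

/-- `circ c σ s t` is `s ∘_σ t` where `∘` is the symbol `c` (used with `plus` and `times`). -/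
def circ {V : Kind → Type} {X : Type} (c : Sym) (σ : Ty V Kind.star) (s t : Term V X) :
    Term V X :=
  app (app (tapp (sym c) σ) s) t

/-- `flatten_σ s`. -/
def flatten {V : Kind → Type} {X : Type} (σ : Ty V Kind.star) (s : Term V X) : Term V X :=
  app (tapp (sym Sym.flatten) σ) s

/-- `lift_σ s`. -/
def lift {V : Kind → Type} {X : Type} (σ : Ty V Kind.star) (s : Term V X) : Term V X :=
  app (tapp (sym Sym.lift) σ) s

/-- The reduction relation `⇝` on interpretation terms. -/
inductive Step : {V : Kind → Type} → {X : Type} → Term V X → Term V X → Prop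
  | lam {V : Kind → Type} {X : Type} (σ : Ty V Kind.star) {s t : Term V (Option X)} :
      Step s t → Step (lam σ s) (lam σ t)
  | tlam {V : Kind → Type} {X : Type} {κ : Kind} {s t : Term (Ext V κ) X} :
      Step s t → Step (tlam κ s) (tlam κ t)
  | app_right {V : Kind → Type} {X : Type} (u : Term V X) {s t : Term V X} :
      Step s t → Step (app u s) (app u t)
  | app_left {V : Kind → Type} {X : Type} {s t : Term V X} (u : Term V X) :
      Step s t → Step (app s u) (app t u)
  | tapp {V : Kind → Type} {X : Type} {κ : Kind} {s t : Term V X} (σ : Ty V κ) :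
      Step s t → Step (tapp s σ) (tapp t σ)
  | beta {V : Kind → Type} {X : Type} (σ : Ty V Kind.star) (s : Term V (Option X))
      (t : Term V X) : Step (app (lam σ s) t) (s.inst t)
  | tbeta {V : Kind → Type} {X : Type} {κ : Kind} (s : Term (Ext V κ) X) (τ : TyCon V κ) :
      Step (tapp (tlam κ s) (Ty.mk τ)) (s.tinst τ)
  | plus_nat {V : Kind → Type} {X : Type} (n m : ℕ) :
      Step (V := V) (X := X) (circ Sym.plus Ty.nat (num n) (num m)) (num (n + m))
  | times_nat {V : Kind → Type} {X : Type} (n m : ℕ) :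
      Step (V := V) (X := X) (circ Sym.times Ty.nat (num n) (num m)) (num (n * m))
  | circ_arrow {V : Kind → Type} {X : Type} (c : Sym) (hc : c = Sym.plus ∨ c = Sym.times)
      (σ τ : Ty V Kind.star) (s t : Term V X) :
      Step (circ c (Ty.arrow σ τ) s t)
        (lam σ (circ c τ (app s.weaken (var none)) (app t.weaken (var none))))
  | circ_all {V : Kind → Type} {X : Type} (c : Sym) (hc : c = Sym.plus ∨ c = Sym.times)
      (κ : Kind) (σ : Ty (Ext V κ) Kind.star) (s t : Term V X) :
      Step (circ c (Ty.all κ σ) s t)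
        (tlam κ (circ c σ (tapp (s.tweaken κ) (Ty.mk (TyCon.var Ext.new)))
          (tapp (t.tweaken κ) (Ty.mk (TyCon.var Ext.new)))))
  | flatten_nat {V : Kind → Type} {X : Type} (s : Term V X) : Step (flatten Ty.nat s) s
  | flatten_arrow {V : Kind → Type} {X : Type} (σ τ : Ty V Kind.star) (s : Term V X) :
      Step (flatten (Ty.arrow σ τ) s) (flatten τ (app s (lift σ (num 0))))
  | flatten_all {V : Kind → Type} {X : Type} (κ : Kind) (σ : Ty (Ext V κ) Kind.star)
      (s : Term V X) :
      Step (flatten (Ty.all κ σ) s)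
        (flatten (σ.inst (TyCon.chi κ)) (tapp s (Ty.mk (TyCon.chi κ))))
  | lift_nat {V : Kind → Type} {X : Type} (s : Term V X) : Step (lift Ty.nat s) s
  | lift_arrow {V : Kind → Type} {X : Type} (σ τ : Ty V Kind.star) (s : Term V X) :
      Step (lift (Ty.arrow σ τ) s) (lam σ (lift τ s.weaken))
  | lift_all {V : Kind → Type} {X : Type} (κ : Kind) (σ : Ty (Ext V κ) Kind.star)
      (s : Term V X) :
      Step (lift (Ty.all κ σ) s) (tlam κ (lift σ (s.tweaken κ)))

def IsNormal {V : Kind → Type} {X : Type} (s : Term V X) : Prop := ∀ t, ¬ Step s t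

open Classical in
/-- The normal form of `s` with respect to `⇝`. -/
noncomputable def nf {V : Kind → Type} {X : Type} (s : Term V X) : Term V X :=
  if h : ∃ t, Relation.ReflTransGen Step s t ∧ t.IsNormal then h.choose else s

end Term

/-! ### The ordering pair -/

/-- Closed raw terms: no free variables of either sort. -/
abbrev ClosedTerm : Type 1 := Term NoVar Empty

/-- `ClosedHasType s σ`: the closed term `s` has the closed type `σ`. -/
def ClosedHasType (s : ClosedTerm) (σ : Ty NoVar Kind.star) : Prop :=
  HasType (fun x : Empty => x.elim) s σ

/-- `q` is a final interpretation term of type `σ`: closed, in normal form, and of type `σ`. -/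
def IsFinal (σ : Ty NoVar Kind.star) (q : ClosedTerm) : Prop := ClosedHasType q σ ∧ q.IsNormal

/-- The three rules for comparing closed terms at a closed `β`-normal type: one inference step,
with comparison of natural numbers `cmp` and with premises in `S`. -/
def CompareStep (cmp : ℕ → ℕ → Prop) (S : TyCon NoVar Kind.star → ClosedTerm → ClosedTerm → Prop)
    (σ : TyCon NoVar Kind.star) (s t : ClosedTerm) : Prop :=
  (σ = TyCon.nat ∧ ∃ n m : ℕ, s.nf = Term.num n ∧ t.nf = Term.num m ∧ cmp n m) ∨
  (∃ σ₁ σ₂ : TyCon NoVar Kind.star, σ = TyCon.arrow σ₁ σ₂ ∧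
    ∀ q : ClosedTerm, IsFinal (Ty.mk σ₁) q → S σ₂ (Term.app s q) (Term.app t q)) ∨
  (∃ (κ : Kind) (ρ : TyCon (Ext NoVar κ) Kind.star), σ = TyCon.all κ ρ ∧
    ∀ τ : TyCon NoVar κ,
      S (Ty.nf (Ty.mk (ρ.inst τ))) (Term.tapp s (Ty.mk τ)) (Term.tapp t (Ty.mk τ)))

/-- The relation defined coinductively by the three rules: the largest relation every instance of
which is the conclusion of a rule whose premises are again instances. -/
def Compare (cmp : ℕ → ℕ → Prop) (σ : TyCon NoVar Kind.star) (s t : ClosedTerm) : Prop :=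
  ∃ S : TyCon NoVar Kind.star → ClosedTerm → ClosedTerm → Prop,
    (∀ ρ a b, S ρ a b → CompareStep cmp S ρ a b) ∧ S σ s t

/-- A closure: a substitution of closed type constructors for the type constructor variables,
and of closed terms of the appropriate types for the term variables. -/
structure Closure {V : Kind → Type} {X : Type} (Γ : X → Ty V Kind.star) where
  tyMap : ∀ κ, V κ → TyCon NoVar κ
  tmMap : X → ClosedTerm
  typed : ∀ x, ClosedHasType (tmMap x) ((Γ x).subst tyMap)

def Closure.onType {V : Kind → Type} {X : Type} {Γ : X → Ty V Kind.star} (C : Closure Γ)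
    (σ : Ty V Kind.star) : Ty NoVar Kind.star :=
  σ.subst C.tyMap

def Closure.onTerm {V : Kind → Type} {X : Type} {Γ : X → Ty V Kind.star} (C : Closure Γ)
    (s : Term V X) : ClosedTerm :=
  (s.tsubst C.tyMap).subst C.tmMap

/-- Comparison of arbitrary terms at an arbitrary type `σ`, through all closures. -/
def CompareOpen (cmp : ℕ → ℕ → Prop) {V : Kind → Type} {X : Type} (Γ : X → Ty V Kind.star)
    (σ : Ty V Kind.star) (s t : Term V X) : Prop :=
  ∀ C : Closure Γ, Compare cmp (Ty.nf (C.onType σ)) (C.onTerm s) (C.onTerm t)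

/-- The set `𝓘_σ` of interpretation terms of type `σ`. -/
abbrev ITermOf {V : Kind → Type} {X : Type} (Γ : X → Ty V Kind.star) (σ : Ty V Kind.star) :
    Type 1 :=
  {s : Term V X // HasType Γ s σ}

/-- The set `𝓘` of interpretation terms. -/
abbrev ITerm {V : Kind → Type} {X : Type} (Γ : X → Ty V Kind.star) : Type 1 :=
  {s : Term V X // ∃ σ, HasType Γ s σ}

/-- `s ≻_σ t`. -/
def SuccAt {V : Kind → Type} {X : Type} (Γ : X → Ty V Kind.star) (σ : Ty V Kind.star)
    (s t : ITermOf Γ σ) : Prop :=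
  CompareOpen (fun n m => n > m) Γ σ s.1 t.1

/-- `s ⪰_σ t`. -/
def SucceqAt {V : Kind → Type} {X : Type} (Γ : X → Ty V Kind.star) (σ : Ty V Kind.star)
    (s t : ITermOf Γ σ) : Prop :=
  CompareOpen (fun n m => n ≥ m) Γ σ s.1 t.1

/-- `s ≻ t`, without type subscript: `s` and `t` have a common type `σ` with `s ≻_σ t`. -/
def Succ {V : Kind → Type} {X : Type} (Γ : X → Ty V Kind.star) (s t : ITerm Γ) : Prop :=
  ∃ (σ : Ty V Kind.star) (hs : HasType Γ s.1 σ) (ht : HasType Γ t.1 σ),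
    SuccAt Γ σ ⟨s.1, hs⟩ ⟨t.1, ht⟩

/-- `s ⪰ t`, without type subscript: `s` and `t` have a common type `σ` with `s ⪰_σ t`. -/
def Succeq {V : Kind → Type} {X : Type} (Γ : X → Ty V Kind.star) (s t : ITerm Γ) : Prop :=
  ∃ (σ : Ty V Kind.star) (hs : HasType Γ s.1 σ) (ht : HasType Γ t.1 σ),
    SucceqAt Γ σ ⟨s.1, hs⟩ ⟨t.1, ht⟩

/-- `gt` is well-founded (no infinite sequence `a₀ gt a₁ gt a₂ gt …`) and transitive, `ge` is
reflexive and transitive, the two are compatible, and `gt` is contained in `ge`. -/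
structure IsOrderingPair {A : Type*} (gt ge : A → A → Prop) : Prop where
  gt_wf : WellFounded (fun a b => gt b a)
  gt_trans : ∀ a b c, gt a b → gt b c → gt a c
  ge_trans : ∀ a b c, ge a b → ge b c → ge a c
  ge_refl : ∀ a, ge a a
  gt_ge : ∀ a b c, gt a b → ge b c → gt a c
  ge_gt : ∀ a b c, ge a b → gt b c → gt a c
  gt_sub_ge : ∀ a b, gt a b → ge a b

end FOmega

/-!
Comparison at `nat` looks at normal forms only, and `Term.nf` is a function, so transitivity,
compatibility and the inclusion of `≻` in `⪰` follow by coinduction from the same facts about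
numbers (`Compare.comp`, `Compare.mono`). For the relations without a type index one also needs that
a term has only one type (`HasType.unique`). This rests on the injectivity of `→` and `∀` modulo
`β`, hence on the confluence of `β`-reduction on type constructors (`TyCon.Steps.confluent`).

Reflexivity needs that every closed term of type `nat` has a numeral as its normal form
(`ClosedHasType.exists_nf_eq_num`). Strong normalization is not required: by subject reduction
(`HasType.steps`) and inspection of closed normal terms (`HasType.closedValue`), it is enough that
such a term reduces to some numeral. That is a Girard-style reducibility argument on closed raw
terms. A candidate for a type `σ` is a set of terms that is closed under expansion and under the
function symbols at `σ` (`IsCandidate`); the index `σ` is necessary because the symbols compute by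
recursion on it. Type constructors are interpreted in a full function-space model over such sets
(`redModel`), whose values at the higher kinds do not depend on the constructors they interpret;
invariance under `β` is therefore an equality (`TyModel.eval_step`), and the dependence on `σ` is
left to a separate predicate `Valid`. The fundamental lemma is `HasType.reducible`.

For well-foundedness one supplies enough arguments to reach type `nat`: a closed normal inhabitant
at every arrow and `χ_κ` at every quantifier. This maps `≻` at a fixed type into `>` on `ℕ`
(`exists_natValue`). The procedure ends because the number of arguments is itself the value of the
type in a model over `ℕ` (`arityModel`), so it is invariant under `β` and drops by one at each step.
-/

namespace FOmega

/-! ### Models of the language of type constructors -/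

/-- The set of values of kind `κ` in the full function-space model over the base set `D`. -/
def Sem (D : Type*) : Kind → Type _
  | .star => D
  | .arr κ₁ κ₂ => Sem D κ₁ → Sem D κ₂

/-- A valuation extended by a value for the newest variable. -/
def extVal {D : Type*} {V : Kind → Type} {κ : Kind} (ξ : ∀ κ', V κ' → Sem D κ') (a : Sem D κ) :
    ∀ κ', Ext V κ κ' → Sem D κ'
  | _, .new => a
  | _, .old x => ξ _ x

/-- The operations on a set `D` that interpret the type constants and type formers. -/
structure TyModel (D : Type*) where
  nat : D
  arrow : D → D → D
  all : (κ : Kind) → (Sem D κ → D) → D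

namespace TyModel

variable {D : Type*} (M : TyModel D)

/-- The value of a type constructor under a valuation of its free variables. -/
def eval : {V : Kind → Type} → {κ : Kind} → (∀ κ', V κ' → Sem D κ') → TyCon V κ → Sem D κ
  | _, _, ξ, .var x => ξ _ x
  | _, _, _, .nat => M.nat
  | _, _, ξ, .app s t => (eval ξ s : Sem D _ → Sem D _) (eval ξ t)
  | _, _, ξ, .lam κ₁ s => fun a : Sem D κ₁ => eval (extVal ξ a) s
  | _, _, ξ, .all κ s => M.all κ fun a => eval (extVal ξ a) s
  | _, _, ξ, .arrow s t => M.arrow (eval ξ s) (eval ξ t)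

theorem eval_rename {V : Kind → Type} {κ : Kind} (t : TyCon V κ) : ∀ {W : Kind → Type}
    (f : ∀ κ', V κ' → W κ') (ξ : ∀ κ', W κ' → Sem D κ'),
    M.eval ξ (t.rename f) = M.eval (fun κ' x => ξ κ' (f κ' x)) t := by
  have key : ∀ {V W : Kind → Type} {κ : Kind} (f : ∀ κ', V κ' → W κ')
      (ξ : ∀ κ', W κ' → Sem D κ') (a : Sem D κ),
      (fun κ' (x : Ext V κ κ') => extVal ξ a κ' (upRen f κ' x))
        = extVal (fun κ' x => ξ κ' (f κ' x)) a := by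
    intro V W κ f ξ a; funext κ' x; cases x <;> rfl
  induction t with
  | var x => intros; rfl
  | nat => intros; rfl
  | app s t ihs iht => intros; simp [TyCon.rename, eval, ihs, iht]
  | lam κ s ih => intros; simp [TyCon.rename, eval, ih, key]; rfl
  | all κ s ih => intros; simp [TyCon.rename, eval, ih, key]; rfl
  | arrow s t ihs iht => intros; simp [TyCon.rename, eval, ihs, iht]; rfl

theorem eval_subst {V : Kind → Type} {κ : Kind} (t : TyCon V κ) : ∀ {W : Kind → Type}
    (θ : ∀ κ', V κ' → TyCon W κ') (ξ : ∀ κ', W κ' → Sem D κ'),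
    M.eval ξ (t.subst θ) = M.eval (fun κ' x => M.eval ξ (θ κ' x)) t := by
  have key : ∀ {V W : Kind → Type} {κ : Kind} (θ : ∀ κ', V κ' → TyCon W κ')
      (ξ : ∀ κ', W κ' → Sem D κ') (a : Sem D κ),
      (fun κ' (x : Ext V κ κ') => M.eval (extVal ξ a) (TyCon.up θ κ' x))
        = extVal (fun κ' x => M.eval ξ (θ κ' x)) a := by
    intro V W κ f ξ a; funext κ' x
    cases x with
    | new => rfl
    | old x => simp [TyCon.up, eval_rename, extVal]
  induction t with
  | var x => intros; rfl
  | nat => intros; rfl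
  | app s t ihs iht => intros; simp [TyCon.subst, eval, ihs, iht]
  | lam κ s ih => intros; simp [TyCon.subst, eval, ih, key]; rfl
  | all κ s ih => intros; simp [TyCon.subst, eval, ih, key]; rfl
  | arrow s t ihs iht => intros; simp [TyCon.subst, eval, ihs, iht]; rfl

theorem eval_inst {V : Kind → Type} {κ κ' : Kind} (φ : TyCon (Ext V κ) κ') (ψ : TyCon V κ)
    (ξ : ∀ κ', V κ' → Sem D κ') :
    M.eval ξ (φ.inst ψ) = M.eval (extVal ξ (M.eval ξ ψ)) φ := by
  rw [TyCon.inst, eval_subst]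
  congr 1
  funext κ'' x
  cases x <;> rfl

theorem eval_step {V : Kind → Type} {κ : Kind} {s t : TyCon V κ} (h : TyCon.Step s t) :
    ∀ ξ : ∀ κ', V κ' → Sem D κ', M.eval ξ s = M.eval ξ t := by
  induction h with
  | beta φ ψ => intro ξ; rw [eval_inst]; rfl
  | app_left t _ ih => intro ξ; simp [eval, ih]
  | app_right s _ ih => intro ξ; simp [eval, ih]
  | lam _ ih => intro ξ; simp [eval, ih]; rfl
  | all _ ih => intro ξ; simp [eval, ih]; rfl
  | arrow_left t _ ih => intro ξ; simp [eval, ih]; rfl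
  | arrow_right s _ ih => intro ξ; simp [eval, ih]; rfl

/-- The value of a type constructor depends on its `β`-class only. -/
def tyEval {V : Kind → Type} {κ : Kind} (ξ : ∀ κ', V κ' → Sem D κ') (σ : Ty V κ) : Sem D κ :=
  Quotient.lift (M.eval ξ) (fun a b (h : Relation.EqvGen TyCon.Step a b) => by
    induction h with
    | rel a b h => exact M.eval_step h ξ
    | refl a => rfl
    | symm a b _ ih => exact ih.symm
    | trans a b c _ _ ih₁ ih₂ => exact ih₁.trans ih₂) σ

variable {V : Kind → Type} (ξ : ∀ κ', V κ' → Sem D κ')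

theorem tyEval_arrow (σ τ : Ty V .star) :
    M.tyEval ξ (Ty.arrow σ τ) = M.arrow (M.tyEval ξ σ) (M.tyEval ξ τ) := by
  obtain ⟨s, rfl⟩ := Quotient.exists_rep σ
  obtain ⟨t, rfl⟩ := Quotient.exists_rep τ
  rfl

theorem tyEval_all {κ : Kind} (σ : Ty (Ext V κ) .star) :
    M.tyEval ξ (Ty.all κ σ) = M.all κ fun a => M.tyEval (extVal ξ a) σ := by
  obtain ⟨s, rfl⟩ := Quotient.exists_rep σ
  rfl

theorem tyEval_inst {κ κ' : Kind} (σ : Ty (Ext V κ) κ') (τ : TyCon V κ) :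
    M.tyEval ξ (σ.inst τ) = M.tyEval (extVal ξ (M.eval ξ τ)) σ := by
  obtain ⟨s, rfl⟩ := Quotient.exists_rep σ
  exact M.eval_inst s τ ξ

theorem tyEval_weaken {κ κ' : Kind} (σ : Ty V κ') (a : Sem D κ) :
    M.tyEval (extVal ξ a) (σ.weaken κ) = M.tyEval ξ σ := by
  obtain ⟨s, rfl⟩ := Quotient.exists_rep σ
  exact M.eval_subst s _ _

end TyModel

/-! ### Confluence of `β`-reduction on type constructors -/

namespace TyCon

/-- Parallel `β`-reduction: any set of redexes that are already present is contracted at once. -/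
inductive Par : {V : Kind → Type} → {κ : Kind} → TyCon V κ → TyCon V κ → Prop
  | var {V : Kind → Type} {κ : Kind} (x : V κ) : Par (var x) (var x)
  | nat {V : Kind → Type} : Par (nat (V := V)) nat
  | app {V : Kind → Type} {κ₁ κ₂ : Kind} {s s' : TyCon V (.arr κ₁ κ₂)} {t t' : TyCon V κ₁} :
      Par s s' → Par t t' → Par (app s t) (app s' t')
  | lam {V : Kind → Type} {κ₁ κ₂ : Kind} {s s' : TyCon (Ext V κ₁) κ₂} :
      Par s s' → Par (lam κ₁ s) (lam κ₁ s')
  | all {V : Kind → Type} {κ : Kind} {s s' : TyCon (Ext V κ) .star} :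
      Par s s' → Par (all κ s) (all κ s')
  | arrow {V : Kind → Type} {s s' t t' : TyCon V .star} :
      Par s s' → Par t t' → Par (arrow s t) (arrow s' t')
  | beta {V : Kind → Type} {κ₁ κ₂ : Kind} {s s' : TyCon (Ext V κ₁) κ₂} {t t' : TyCon V κ₁} :
      Par s s' → Par t t' → Par (app (lam κ₁ s) t) (inst s' t')

theorem Par.refl {V : Kind → Type} {κ : Kind} (t : TyCon V κ) : Par t t := by
  induction t with
  | var x => exact .var x
  | nat => exact .nat
  | app s t ihs iht => exact .app ihs iht
  | lam κ s ih => exact .lam ih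
  | all κ s ih => exact .all ih
  | arrow s t ihs iht => exact .arrow ihs iht

theorem Step.par {V : Kind → Type} {κ : Kind} {s t : TyCon V κ} (h : Step s t) : Par s t := by
  induction h with
  | beta φ ψ => exact .beta (.refl _) (.refl _)
  | app_left t _ ih => exact .app ih (.refl _)
  | app_right s _ ih => exact .app (.refl _) ih
  | lam _ ih => exact .lam ih
  | all _ ih => exact .all ih
  | arrow_left t _ ih => exact .arrow ih (.refl _)
  | arrow_right s _ ih => exact .arrow (.refl _) ih

/-- `β`-reduction in any number of steps. -/
abbrev Steps {V : Kind → Type} {κ : Kind} : TyCon V κ → TyCon V κ → Prop :=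
  Relation.ReflTransGen Step

theorem Steps.app {V : Kind → Type} {κ₁ κ₂ : Kind} {s s' : TyCon V (.arr κ₁ κ₂)}
    {t t' : TyCon V κ₁} (hs : Steps s s') (ht : Steps t t') : Steps (app s t) (app s' t') :=
  (hs.lift (fun a => TyCon.app a t) fun _ _ h => .app_left _ h).trans
    (ht.lift (fun b => TyCon.app s' b) fun _ _ h => .app_right _ h)

theorem Steps.lam {V : Kind → Type} {κ₁ κ₂ : Kind} {s s' : TyCon (Ext V κ₁) κ₂}
    (hs : Steps s s') : Steps (lam κ₁ s) (lam κ₁ s') :=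
  hs.lift (TyCon.lam κ₁) fun _ _ h => .lam h

theorem Steps.all {V : Kind → Type} {κ : Kind} {s s' : TyCon (Ext V κ) .star}
    (hs : Steps s s') : Steps (all κ s) (all κ s') :=
  hs.lift (TyCon.all κ) fun _ _ h => .all h

theorem Steps.arrow {V : Kind → Type} {s s' t t' : TyCon V .star} (hs : Steps s s')
    (ht : Steps t t') : Steps (arrow s t) (arrow s' t') :=
  (hs.lift (fun a => TyCon.arrow a t) fun _ _ h => .arrow_left _ h).trans
    (ht.lift (fun b => TyCon.arrow s' b) fun _ _ h => .arrow_right _ h)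

theorem Par.steps {V : Kind → Type} {κ : Kind} {s t : TyCon V κ} (h : Par s t) : Steps s t := by
  induction h with
  | var x => exact .refl
  | nat => exact .refl
  | app _ _ ihs iht => exact ihs.app iht
  | lam _ ih => exact ih.lam
  | all _ ih => exact ih.all
  | arrow _ _ ihs iht => exact ihs.arrow iht
  | beta _ _ ihs iht => exact (ihs.lam.app iht).tail (.beta _ _)

theorem rename_eq_subst {V : Kind → Type} {κ : Kind} (t : TyCon V κ) {W : Kind → Type}
    (f : ∀ κ', V κ' → W κ') : rename f t = subst (fun κ' x => var (f κ' x)) t := by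
  rw [← subst_var (rename f t), subst_rename]

theorem Par.subst_right {V : Kind → Type} {κ : Kind} {s t : TyCon V κ} (h : Par s t) :
    ∀ {W : Kind → Type} (θ : ∀ κ', V κ' → TyCon W κ'), Par (subst θ s) (subst θ t) := by
  induction h with
  | var x => intros; exact .refl _
  | nat => intros; exact .nat
  | app _ _ ihs iht => intro W θ; exact .app (ihs θ) (iht θ)
  | lam _ ih => intro W θ; exact .lam (ih _)
  | all _ ih => intro W θ; exact .all (ih _)
  | arrow _ _ ihs iht => intro W θ; exact .arrow (ihs θ) (iht θ)
  | beta _ _ ihs iht => intro W θ; rw [subst_inst]; exact .beta (ihs _) (iht _)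

theorem Par.rename {V W : Kind → Type} {κ : Kind} {s t : TyCon V κ} (h : Par s t)
    (f : ∀ κ', V κ' → W κ') : Par (rename f s) (rename f t) := by
  rw [rename_eq_subst, rename_eq_subst]; exact h.subst_right _

theorem Par.up {V W : Kind → Type} {κ : Kind} {θ η : ∀ κ', V κ' → TyCon W κ'}
    (h : ∀ κ' x, Par (θ κ' x) (η κ' x)) :
    ∀ κ' x, Par (up (κ := κ) θ κ' x) (TyCon.up η κ' x) := by
  intro κ' x
  cases x with
  | new => exact .refl _
  | old x => exact (h _ x).rename _

theorem Par.subst {V : Kind → Type} {κ : Kind} {s t : TyCon V κ} (h : Par s t) :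
    ∀ {W : Kind → Type} {θ η : ∀ κ', V κ' → TyCon W κ'} (_ : ∀ κ' x, Par (θ κ' x) (η κ' x)),
    Par (subst θ s) (subst η t) := by
  induction h with
  | var x => intro W θ η hθ; exact hθ _ x
  | nat => intros; exact .nat
  | app _ _ ihs iht => intro W θ η hθ; exact .app (ihs hθ) (iht hθ)
  | lam _ ih => intro W θ η hθ; exact .lam (ih (Par.up hθ))
  | all _ ih => intro W θ η hθ; exact .all (ih (Par.up hθ))
  | arrow _ _ ihs iht => intro W θ η hθ; exact .arrow (ihs hθ) (iht hθ)
  | beta _ _ ihs iht =>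
    intro W θ η hθ; rw [subst_inst]; exact .beta (ihs (Par.up hθ)) (iht hθ)

theorem Par.inst {V : Kind → Type} {κ κ' : Kind} {s s' : TyCon (Ext V κ) κ'} {t t' : TyCon V κ}
    (hs : Par s s') (ht : Par t t') : Par (inst s t) (inst s' t') := by
  refine hs.subst fun κ'' x => ?_
  cases x with
  | new => exact ht
  | old x => exact .refl _

/-- Parallel reduction has the diamond property. -/
theorem Par.diamond {V : Kind → Type} {κ : Kind} {a b : TyCon V κ} (h : Par a b) :
    ∀ {c : TyCon V κ}, Par a c → ∃ d, Par b d ∧ Par c d := by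
  induction h with
  | var x => intro c h; cases h; exact ⟨_, .refl _, .refl _⟩
  | nat => intro c h; cases h; exact ⟨_, .refl _, .refl _⟩
  | @app _ _ _ s s' t t' hs ht ihs iht =>
    intro c h
    cases h with
    | app h₁ h₂ =>
      obtain ⟨d₁, h₃, h₄⟩ := ihs h₁
      obtain ⟨d₂, h₅, h₆⟩ := iht h₂
      exact ⟨_, .app h₃ h₅, .app h₄ h₆⟩
    | beta h₁ h₂ =>
      obtain ⟨d₁, h₃, h₄⟩ := ihs (.lam h₁)
      obtain ⟨d₂, h₅, h₆⟩ := iht h₂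
      cases hs with
      | lam hs =>
        cases h₄ with
        | lam h₄ =>
          cases h₃ with
          | lam h₃ => exact ⟨_, .beta h₃ h₅, h₄.inst h₆⟩
  | lam _ ih =>
    intro c h
    cases h with
    | lam h => obtain ⟨d, h₁, h₂⟩ := ih h; exact ⟨_, .lam h₁, .lam h₂⟩
  | all _ ih =>
    intro c h
    cases h with
    | all h => obtain ⟨d, h₁, h₂⟩ := ih h; exact ⟨_, .all h₁, .all h₂⟩
  | arrow _ _ ihs iht =>
    intro c h
    cases h with
    | arrow h₁ h₂ =>
      obtain ⟨d₁, h₃, h₄⟩ := ihs h₁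
      obtain ⟨d₂, h₅, h₆⟩ := iht h₂
      exact ⟨_, .arrow h₃ h₅, .arrow h₄ h₆⟩
  | beta _ _ ihs iht =>
    intro c h
    cases h with
    | app h₁ h₂ =>
      cases h₁ with
      | lam h₁ =>
        obtain ⟨d₁, h₃, h₄⟩ := ihs h₁
        obtain ⟨d₂, h₅, h₆⟩ := iht h₂
        exact ⟨_, h₃.inst h₅, .beta h₄ h₆⟩
    | beta h₁ h₂ =>
      obtain ⟨d₁, h₃, h₄⟩ := ihs h₁
      obtain ⟨d₂, h₅, h₆⟩ := iht h₂
      exact ⟨_, h₃.inst h₅, h₄.inst h₆⟩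

theorem par_steps_iff {V : Kind → Type} {κ : Kind} {a b : TyCon V κ} :
    Relation.ReflTransGen Par a b ↔ Steps a b := by
  constructor
  · intro h
    induction h with
    | refl => exact .refl
    | tail _ h ih => exact ih.trans h.steps
  · exact fun h => Relation.ReflTransGen.mono (fun _ _ => Step.par) _ _ h

theorem Steps.confluent {V : Kind → Type} {κ : Kind} {a b c : TyCon V κ} (hb : Steps a b)
    (hc : Steps a c) : ∃ d, Steps b d ∧ Steps c d := by
  obtain ⟨d, h₁, h₂⟩ := Relation.church_rosser (r := Par (V := V) (κ := κ))
    (fun a b c hb hc => by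
      obtain ⟨d, h₁, h₂⟩ := hb.diamond hc
      exact ⟨d, .single h₁, .single h₂⟩)
    (par_steps_iff.2 hb) (par_steps_iff.2 hc)
  exact ⟨d, par_steps_iff.1 h₁, par_steps_iff.1 h₂⟩

end TyCon

namespace Ty

open TyCon (Steps)

theorem mk_eq_of_step {V : Kind → Type} {κ : Kind} {a b : TyCon V κ} (h : TyCon.Step a b) :
    mk a = mk b :=
  Quotient.sound (.rel _ _ h)

theorem mk_eq_of_steps {V : Kind → Type} {κ : Kind} {a b : TyCon V κ} (h : Steps a b) :
    mk a = mk b := by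
  induction h with
  | refl => rfl
  | tail _ h ih => exact ih.trans (mk_eq_of_step h)

/-- The Church–Rosser property. -/
theorem exists_steps_of_mk_eq {V : Kind → Type} {κ : Kind} {a b : TyCon V κ} (h : mk a = mk b) :
    ∃ c, Steps a c ∧ Steps b c := by
  have h' : Relation.EqvGen TyCon.Step a b := Quotient.exact h
  clear h
  induction h' with
  | rel a b h => exact ⟨b, .single h, .refl⟩
  | refl a => exact ⟨a, .refl, .refl⟩
  | symm a b _ ih => obtain ⟨c, h₁, h₂⟩ := ih; exact ⟨c, h₂, h₁⟩
  | trans a b c _ _ ih₁ ih₂ =>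
    obtain ⟨d, h₁, h₂⟩ := ih₁
    obtain ⟨e, h₃, h₄⟩ := ih₂
    obtain ⟨g, h₅, h₆⟩ := h₂.confluent h₃
    exact ⟨g, h₁.trans h₅, h₄.trans h₆⟩

theorem exists_mk {V : Kind → Type} {κ : Kind} (σ : Ty V κ) : ∃ τ, mk τ = σ :=
  Quotient.exists_rep σ

end Ty

namespace TyCon

theorem Steps.eq_arrow {V : Kind → Type} {a b c : TyCon V .star} (h : Steps (TyCon.arrow a b) c) :
    ∃ a' b', c = TyCon.arrow a' b' ∧ Steps a a' ∧ Steps b b' := by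
  induction h with
  | refl => exact ⟨a, b, rfl, .refl, .refl⟩
  | tail _ h ih =>
    obtain ⟨a', b', rfl, ha, hb⟩ := ih
    cases h with
    | arrow_left _ h => exact ⟨_, _, rfl, ha.tail h, hb⟩
    | arrow_right _ h => exact ⟨_, _, rfl, ha, hb.tail h⟩

theorem Steps.eq_all {V : Kind → Type} {κ : Kind} {a : TyCon (Ext V κ) .star} {c : TyCon V .star}
    (h : Steps (TyCon.all κ a) c) : ∃ a', c = TyCon.all κ a' ∧ Steps a a' := by
  induction h with
  | refl => exact ⟨a, rfl, .refl⟩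
  | tail _ h ih =>
    obtain ⟨a', rfl, ha⟩ := ih
    cases h with
    | all h => exact ⟨_, rfl, ha.tail h⟩

theorem IsNormal.eq_of_steps {V : Kind → Type} {κ : Kind} {a b : TyCon V κ} (ha : a.IsNormal)
    (h : Steps a b) : b = a := by
  cases Relation.ReflTransGen.cases_head h with
  | inl h => exact h.symm
  | inr h => obtain ⟨c, h, _⟩ := h; exact (ha c h).elim

theorem isNormal_nat {V : Kind → Type} : (nat (V := V)).IsNormal := fun _ h => by cases h

end TyCon

namespace Ty

open TyCon (Steps)

theorem arrow_inj {V : Kind → Type} {σ τ σ' τ' : Ty V .star} (h : arrow σ τ = arrow σ' τ') :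
    σ = σ' ∧ τ = τ' := by
  obtain ⟨a, rfl⟩ := exists_mk σ
  obtain ⟨b, rfl⟩ := exists_mk τ
  obtain ⟨a', rfl⟩ := exists_mk σ'
  obtain ⟨b', rfl⟩ := exists_mk τ'
  obtain ⟨c, h₁, h₂⟩ := exists_steps_of_mk_eq (a := TyCon.arrow a b) (b := TyCon.arrow a' b') h
  obtain ⟨a₁, b₁, rfl, ha₁, hb₁⟩ := h₁.eq_arrow
  obtain ⟨a₂, b₂, e, ha₂, hb₂⟩ := h₂.eq_arrow
  cases e
  exact ⟨(mk_eq_of_steps ha₁).trans (mk_eq_of_steps ha₂).symm,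
    (mk_eq_of_steps hb₁).trans (mk_eq_of_steps hb₂).symm⟩

theorem all_kind_inj {V : Kind → Type} {κ κ' : Kind} {σ : Ty (Ext V κ) .star}
    {σ' : Ty (Ext V κ') .star} (h : all κ σ = all κ' σ') : κ = κ' := by
  obtain ⟨a, rfl⟩ := exists_mk σ
  obtain ⟨a', rfl⟩ := exists_mk σ'
  obtain ⟨c, h₁, h₂⟩ := exists_steps_of_mk_eq (a := TyCon.all κ a) (b := TyCon.all κ' a') h
  obtain ⟨a₁, rfl, ha₁⟩ := h₁.eq_all
  obtain ⟨a₂, e, ha₂⟩ := h₂.eq_all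
  cases e
  rfl

theorem all_inj {V : Kind → Type} {κ : Kind} {σ σ' : Ty (Ext V κ) .star}
    (h : all κ σ = all κ σ') : σ = σ' := by
  obtain ⟨a, rfl⟩ := exists_mk σ
  obtain ⟨a', rfl⟩ := exists_mk σ'
  obtain ⟨c, h₁, h₂⟩ := exists_steps_of_mk_eq (a := TyCon.all κ a) (b := TyCon.all κ a') h
  obtain ⟨a₁, rfl, ha₁⟩ := h₁.eq_all
  obtain ⟨a₂, e, ha₂⟩ := h₂.eq_all
  cases e
  exact (mk_eq_of_steps ha₁).trans (mk_eq_of_steps ha₂).symm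

/-- A normal type that is convertible to an arrow type is an arrow type. -/
theorem exists_eq_arrow {V : Kind → Type} {φ : TyCon V .star} (hφ : φ.IsNormal)
    {σ τ : Ty V .star} (h : mk φ = arrow σ τ) : ∃ a b, φ = TyCon.arrow a b := by
  obtain ⟨a, rfl⟩ := exists_mk σ
  obtain ⟨b, rfl⟩ := exists_mk τ
  obtain ⟨c, h₁, h₂⟩ := exists_steps_of_mk_eq (b := TyCon.arrow a b) h
  obtain ⟨a₁, b₁, rfl, -, -⟩ := h₂.eq_arrow
  exact ⟨a₁, b₁, (hφ.eq_of_steps h₁).symm⟩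

theorem exists_eq_all {V : Kind → Type} {φ : TyCon V .star} (hφ : φ.IsNormal)
    {κ : Kind} {σ : Ty (Ext V κ) .star} (h : mk φ = all κ σ) : ∃ a, φ = TyCon.all κ a := by
  obtain ⟨a, rfl⟩ := exists_mk σ
  obtain ⟨c, h₁, h₂⟩ := exists_steps_of_mk_eq (b := TyCon.all κ a) h
  obtain ⟨a₁, rfl, -⟩ := h₂.eq_all
  exact ⟨a₁, (hφ.eq_of_steps h₁).symm⟩

theorem eq_nat_of_mk_eq {V : Kind → Type} {φ : TyCon V .star} (hφ : φ.IsNormal)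
    (h : mk φ = nat) : φ = TyCon.nat := by
  obtain ⟨c, h₁, h₂⟩ := exists_steps_of_mk_eq (b := TyCon.nat) h
  rw [← hφ.eq_of_steps h₁, TyCon.isNormal_nat.eq_of_steps h₂]

theorem nat_ne_arrow {V : Kind → Type} {σ τ : Ty V .star} : nat ≠ arrow σ τ := by
  intro h
  obtain ⟨a, b, h⟩ := exists_eq_arrow TyCon.isNormal_nat h
  cases h

theorem nat_ne_all {V : Kind → Type} {κ : Kind} {σ : Ty (Ext V κ) .star} : nat ≠ all κ σ := by
  intro h
  obtain ⟨a, h⟩ := exists_eq_all TyCon.isNormal_nat h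
  cases h

theorem arrow_ne_all {V : Kind → Type} {σ τ : Ty V .star} {κ : Kind} {ρ : Ty (Ext V κ) .star} :
    arrow σ τ ≠ all κ ρ := by
  intro h
  obtain ⟨a, rfl⟩ := exists_mk σ
  obtain ⟨b, rfl⟩ := exists_mk τ
  obtain ⟨r, rfl⟩ := exists_mk ρ
  obtain ⟨c, h₁, h₂⟩ := exists_steps_of_mk_eq (a := TyCon.arrow a b) (b := TyCon.all κ r) h
  obtain ⟨a₁, b₁, rfl, -, -⟩ := h₁.eq_arrow
  obtain ⟨a₂, e, -⟩ := h₂.eq_all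
  cases e

end Ty

/-! ### Normalization of type constructors -/

namespace TyCon

/-- `NormalForm b t`: the grammar of `β`-normal type constructors; `b = true` restricts it to the
neutral ones, which are variables applied to normal arguments. -/
inductive NormalForm : {V : Kind → Type} → {κ : Kind} → Bool → TyCon V κ → Prop
  | var {V : Kind → Type} {κ : Kind} (x : V κ) : NormalForm true (var x)
  | app {V : Kind → Type} {κ₁ κ₂ : Kind} {s : TyCon V (.arr κ₁ κ₂)} {t : TyCon V κ₁} :
      NormalForm true s → NormalForm false t → NormalForm true (app s t)
  | neutral {V : Kind → Type} {κ : Kind} {t : TyCon V κ} :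
      NormalForm true t → NormalForm false t
  | nat {V : Kind → Type} : NormalForm false (nat (V := V))
  | lam {V : Kind → Type} {κ₁ κ₂ : Kind} {s : TyCon (Ext V κ₁) κ₂} :
      NormalForm false s → NormalForm false (lam κ₁ s)
  | all {V : Kind → Type} {κ : Kind} {s : TyCon (Ext V κ) .star} :
      NormalForm false s → NormalForm false (all κ s)
  | arrow {V : Kind → Type} {s t : TyCon V .star} :
      NormalForm false s → NormalForm false t → NormalForm false (arrow s t)

theorem NormalForm.isNormal {V : Kind → Type} {κ : Kind} {b : Bool} {t : TyCon V κ}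
    (h : NormalForm b t) : t.IsNormal := by
  induction h with
  | var x => intro t' h; cases h
  | app hs _ ihs iht =>
    intro t' h
    cases h with
    | beta => cases hs
    | app_left _ h => exact ihs _ h
    | app_right _ h => exact iht _ h
  | neutral _ ih => exact ih
  | nat => exact isNormal_nat
  | lam _ ih => intro t' h; cases h with | lam h => exact ih _ h
  | all _ ih => intro t' h; cases h with | all h => exact ih _ h
  | arrow _ _ ihs iht =>
    intro t' h
    cases h with
    | arrow_left _ h => exact ihs _ h
    | arrow_right _ h => exact iht _ h

theorem NormalForm.rename {V : Kind → Type} {κ : Kind} {b : Bool} {t : TyCon V κ}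
    (h : NormalForm b t) : ∀ {W : Kind → Type} (f : ∀ κ', V κ' → W κ'),
    NormalForm b (t.rename f) := by
  induction h with
  | var x => intros; exact .var _
  | app _ _ ihs iht => intros; exact .app (ihs _) (iht _)
  | neutral _ ih => intros; exact .neutral (ih _)
  | nat => intros; exact .nat
  | lam _ ih => intros; exact .lam (ih _)
  | all _ ih => intros; exact .all (ih _)
  | arrow _ _ ihs iht => intros; exact .arrow (ihs _) (iht _)

theorem Steps.rename {V W : Kind → Type} {κ : Kind} {s t : TyCon V κ} (h : Steps s t)
    (f : ∀ κ', V κ' → W κ') : Steps (rename f s) (rename f t) := by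
  simp only [rename_eq_subst]
  exact h.lift _ fun _ _ h => h.subst _

/-- `t` reduces to a normal form. -/
def HasNormalForm {V : Kind → Type} {κ : Kind} (t : TyCon V κ) : Prop :=
  ∃ n, Steps t n ∧ NormalForm false n

/-- Tait's computability predicate, stable under the addition of variables: a computable
constructor has a normal form and, after any renaming, maps computable arguments to computable
results. -/
def Computable : (κ : Kind) → {V : Kind → Type} → TyCon V κ → Prop
  | .star, _, t => HasNormalForm t
  | .arr κ₁ κ₂, V, t => HasNormalForm t ∧ ∀ (W : Kind → Type) (f : ∀ κ', V κ' → W κ')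
      (u : TyCon W κ₁), Computable κ₁ u → Computable κ₂ (app (rename f t) u)

theorem Computable.hasNormalForm : ∀ {κ : Kind} {V : Kind → Type} {t : TyCon V κ},
    Computable κ t → HasNormalForm t
  | .star, _, _, h => h
  | .arr _ _, _, _, h => h.1

theorem HasNormalForm.of_steps {V : Kind → Type} {κ : Kind} {s t : TyCon V κ} (h : Steps s t)
    (ht : HasNormalForm t) : HasNormalForm s :=
  ht.imp fun _ hn => ⟨h.trans hn.1, hn.2⟩

theorem Computable.of_steps : ∀ {κ : Kind} {V : Kind → Type} {s t : TyCon V κ}, Steps s t →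
    Computable κ t → Computable κ s
  | .star, _, _, _, h, ht => HasNormalForm.of_steps h ht
  | .arr _ _, _, _, _, h, ht => ⟨ht.1.of_steps h, fun W f u hu =>
      Computable.of_steps ((h.rename f).app .refl) (ht.2 W f u hu)⟩

theorem NormalForm.computable : ∀ {κ : Kind} {V : Kind → Type} {t : TyCon V κ},
    NormalForm true t → Computable κ t
  | .star, _, _, h => ⟨_, .refl, .neutral h⟩
  | .arr _ _, _, _, h => ⟨⟨_, .refl, .neutral h⟩, fun W f u hu => by
      obtain ⟨n, hn, hn'⟩ := hu.hasNormalForm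
      exact Computable.of_steps (Steps.app .refl hn)
        (NormalForm.computable ((h.rename f).app hn'))⟩

theorem Computable.rename : ∀ {κ : Kind} {V W : Kind → Type} {t : TyCon V κ}
    (f : ∀ κ', V κ' → W κ'), Computable κ t → Computable κ (rename f t) := by
  have key : ∀ {κ : Kind} {V W : Kind → Type} {t : TyCon V κ} (f : ∀ κ', V κ' → W κ'),
      HasNormalForm t → HasNormalForm (TyCon.rename f t) :=
    fun f ⟨n, h, hn⟩ => ⟨_, h.rename f, hn.rename f⟩
  intro κ V W t f h
  cases κ with
  | star => exact key f h
  | arr κ₁ κ₂ =>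
    refine ⟨key f h.1, fun U g u hu => ?_⟩
    rw [rename_rename]
    exact h.2 U _ u hu

theorem Computable.up {V W : Kind → Type} {κ : Kind} {θ : ∀ κ', V κ' → TyCon W κ'}
    (hθ : ∀ κ' x, Computable κ' (θ κ' x)) (κ' : Kind) (x : Ext V κ κ') :
    Computable κ' (TyCon.up θ κ' x) := by
  cases x with
  | new => exact (NormalForm.var _).computable
  | old x => exact (hθ _ x).rename _

theorem computable_subst {V : Kind → Type} {κ : Kind} (t : TyCon V κ) :
    ∀ {W : Kind → Type} {θ : ∀ κ', V κ' → TyCon W κ'}, (∀ κ' x, Computable κ' (θ κ' x)) →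
    Computable κ (t.subst θ) := by
  induction t with
  | var x => intro W θ hθ; exact hθ _ x
  | nat => intros; exact ⟨_, .refl, .nat⟩
  | app s t ihs iht =>
    intro W θ hθ
    have h := (ihs hθ).2 W (fun _ x => x) _ (iht hθ)
    rwa [rename_eq_subst, subst_var] at h
  | @lam V κ₁ κ₂ s ih =>
    intro W θ hθ
    obtain ⟨n, hn, hn'⟩ := (ih (Computable.up hθ)).hasNormalForm
    refine ⟨⟨_, hn.lam, hn'.lam⟩, fun U f u hu => ?_⟩
    refine Computable.of_steps (.single (Step.beta _ _)) ?_
    have e : inst (TyCon.rename (upRen f) (TyCon.subst (TyCon.up θ) s)) u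
        = s.subst (fun κ' (x : Ext V κ₁ κ') =>
            TyCon.subst (single u) (TyCon.rename (upRen f) (TyCon.up θ κ' x))) := by
      rw [inst, rename_subst, subst_subst]
    rw [e]
    refine ih fun κ' x => ?_
    cases x with
    | new => exact hu
    | old x =>
      have e : TyCon.subst (single u) (TyCon.rename (upRen f) (TyCon.up θ κ' (.old x)))
          = TyCon.rename f (θ κ' x) := by
        rw [TyCon.up, rename_rename, subst_rename, rename_eq_subst]; rfl
      rw [e]
      exact (hθ _ x).rename f
  | all κ s ih =>
    intro W θ hθ
    obtain ⟨n, hn, hn'⟩ := (ih (Computable.up hθ)).hasNormalForm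
    exact ⟨_, hn.all, hn'.all⟩
  | arrow s t ihs iht =>
    intro W θ hθ
    obtain ⟨m, hm, hm'⟩ := ihs hθ
    obtain ⟨n, hn, hn'⟩ := iht hθ
    exact ⟨_, hm.arrow hn, hm'.arrow hn'⟩

/-- Weak normalization, by computability under the identity substitution. -/
theorem hasNormalForm {V : Kind → Type} {κ : Kind} (t : TyCon V κ) : HasNormalForm t := by
  have h := computable_subst t (W := V) (θ := fun _ x => var x)
    fun _ x => (NormalForm.var x).computable
  rw [subst_var] at h
  exact h.hasNormalForm

theorem IsNormal.normalForm {V : Kind → Type} {κ : Kind} {t : TyCon V κ} (h : t.IsNormal) :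
    NormalForm false t := by
  obtain ⟨n, hn, hn'⟩ := t.hasNormalForm
  rwa [h.eq_of_steps hn] at hn'

theorem NormalForm.not_neutral {V : Kind → Type} (hV : ∀ κ, IsEmpty (V κ)) {κ : Kind}
    {t : TyCon V κ} : ¬ NormalForm true t := by
  intro h
  generalize hb : true = b at h
  induction h with
  | var x => exact (hV _).false x
  | app _ _ ih => exact ih hV rfl
  | _ => cases hb

/-- A closed normal type is `nat`, an arrow type or a quantified type. -/
theorem NormalForm.closed_cases {V : Kind → Type} (hV : ∀ κ, IsEmpty (V κ)) {t : TyCon V .star}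
    (h : NormalForm false t) :
    t = TyCon.nat ∨ (∃ a b, t = TyCon.arrow a b) ∨ ∃ κ a, t = TyCon.all κ a := by
  cases h with
  | neutral h => exact (h.not_neutral hV).elim
  | nat => exact .inl rfl
  | all => exact .inr (.inr ⟨_, _, rfl⟩)
  | arrow => exact .inr (.inl ⟨_, _, rfl⟩)

end TyCon

namespace Ty

theorem nf_spec {V : Kind → Type} {κ : Kind} (σ : Ty V κ) : mk (nf σ) = σ ∧ (nf σ).IsNormal := by
  have h : ∃ τ : TyCon V κ, mk τ = σ ∧ τ.IsNormal := by
    obtain ⟨t, rfl⟩ := exists_mk σ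
    obtain ⟨n, hn, hn'⟩ := t.hasNormalForm
    exact ⟨n, (mk_eq_of_steps hn).symm, hn'.isNormal⟩
  rw [nf, dif_pos h]
  exact h.choose_spec

theorem closed_cases {V : Kind → Type} (hV : ∀ κ, IsEmpty (V κ)) (σ : Ty V .star) :
    σ = nat ∨ (∃ a b, σ = arrow a b) ∨ ∃ κ a, σ = all κ a := by
  obtain ⟨h, hn⟩ := nf_spec σ
  rcases hn.normalForm.closed_cases hV with e | ⟨a, b, e⟩ | ⟨κ, a, e⟩
  · exact .inl (by rw [← h, e]; rfl)
  · exact .inr (.inl ⟨mk a, mk b, by rw [← h, e]; rfl⟩)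
  · exact .inr (.inr ⟨κ, mk a, by rw [← h, e]; rfl⟩)

/-! ### Substitution in types modulo `β` -/

theorem subst_subst {V W U : Kind → Type} {κ : Kind} (σ : Ty V κ)
    (θ : ∀ κ', V κ' → TyCon W κ') (η : ∀ κ', W κ' → TyCon U κ') :
    (σ.subst θ).subst η = σ.subst (fun κ' x => (θ κ' x).subst η) := by
  obtain ⟨t, rfl⟩ := exists_mk σ
  exact congrArg mk (TyCon.subst_subst t θ η)

theorem subst_var {V : Kind → Type} {κ : Kind} (σ : Ty V κ) :
    σ.subst (fun _ x => .var x) = σ := by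
  obtain ⟨t, rfl⟩ := exists_mk σ
  exact congrArg mk (TyCon.subst_var t)

theorem subst_arrow {V W : Kind → Type} (σ τ : Ty V .star) (θ : ∀ κ', V κ' → TyCon W κ') :
    (arrow σ τ).subst θ = arrow (σ.subst θ) (τ.subst θ) := by
  obtain ⟨s, rfl⟩ := exists_mk σ
  obtain ⟨t, rfl⟩ := exists_mk τ
  rfl

theorem subst_all {V W : Kind → Type} {κ : Kind} (σ : Ty (Ext V κ) .star)
    (θ : ∀ κ', V κ' → TyCon W κ') : (all κ σ).subst θ = all κ (σ.subst (TyCon.up θ)) := by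
  obtain ⟨s, rfl⟩ := exists_mk σ
  rfl

theorem subst_inst {V W : Kind → Type} {κ κ' : Kind} (σ : Ty (Ext V κ) κ') (τ : TyCon V κ)
    (θ : ∀ κ', V κ' → TyCon W κ') :
    (σ.inst τ).subst θ = (σ.subst (TyCon.up θ)).inst (τ.subst θ) := by
  obtain ⟨s, rfl⟩ := exists_mk σ
  exact congrArg mk (TyCon.subst_inst s τ θ)

theorem weaken_subst {V W : Kind → Type} {κ κ' : Kind} (σ : Ty V κ')
    (θ : ∀ κ', V κ' → TyCon W κ') :
    (σ.weaken κ).subst (TyCon.up θ) = (σ.subst θ).weaken κ := by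
  rw [weaken, weaken, subst_subst, subst_subst]
  congr 1
  funext κ'' x
  exact TyCon.rename_eq_subst _ _

theorem weaken_inst {V : Kind → Type} {κ κ' : Kind} (σ : Ty V κ') (τ : TyCon V κ) :
    (σ.weaken κ).inst τ = σ := by
  rw [weaken, inst, subst_subst]
  exact subst_var σ

theorem mk_app_congr {V : Kind → Type} {κ₁ κ₂ : Kind} {s s' : TyCon V (.arr κ₁ κ₂)}
    {t t' : TyCon V κ₁} (hs : mk s = mk s') (ht : mk t = mk t') :
    mk (s.app t) = mk (s'.app t') := by
  obtain ⟨c, h₁, h₂⟩ := exists_steps_of_mk_eq hs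
  obtain ⟨d, h₃, h₄⟩ := exists_steps_of_mk_eq ht
  exact (mk_eq_of_steps (h₁.app h₃)).trans (mk_eq_of_steps (h₂.app h₄)).symm

theorem mk_lam_congr {V : Kind → Type} {κ₁ κ₂ : Kind} {s s' : TyCon (Ext V κ₁) κ₂}
    (hs : mk s = mk s') : mk (s.lam) = mk (s'.lam) := by
  obtain ⟨c, h₁, h₂⟩ := exists_steps_of_mk_eq hs
  exact (mk_eq_of_steps h₁.lam).trans (mk_eq_of_steps h₂.lam).symm

/-- `β`-equal substitutions have `β`-equal results. -/
theorem mk_subst_congr {V : Kind → Type} {κ : Kind} (t : TyCon V κ) : ∀ {W : Kind → Type}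
    {θ η : ∀ κ', V κ' → TyCon W κ'}, (∀ κ' x, mk (θ κ' x) = mk (η κ' x)) →
    mk (t.subst θ) = mk (t.subst η) := by
  have key : ∀ {V W : Kind → Type} {κ : Kind} {θ η : ∀ κ', V κ' → TyCon W κ'},
      (∀ κ' x, mk (θ κ' x) = mk (η κ' x)) →
      ∀ κ' x, mk (TyCon.up (κ := κ) θ κ' x) = mk (TyCon.up η κ' x) := by
    intro V W κ θ η h κ' x
    cases x with
    | new => rfl
    | old x =>
      simp only [TyCon.up, TyCon.rename_eq_subst]
      exact congrArg (Ty.weaken κ) (h _ x)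
  induction t with
  | var x => intro W θ η h; exact h _ x
  | nat => intros; rfl
  | app s t ihs iht => intro W θ η h; exact mk_app_congr (ihs h) (iht h)
  | lam κ s ih => intro W θ η h; exact mk_lam_congr (ih (key h))
  | all κ s ih => intro W θ η h; exact congrArg (all κ) (ih (key h))
  | arrow s t ihs iht => intro W θ η h; exact congrArg₂ arrow (ihs h) (iht h)

theorem inst_congr {V : Kind → Type} {κ κ' : Kind} (σ : Ty (Ext V κ) κ') {τ τ' : TyCon V κ}
    (h : mk τ = mk τ') : σ.inst τ = σ.inst τ' := by
  obtain ⟨s, rfl⟩ := exists_mk σ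
  refine mk_subst_congr s fun κ'' x => ?_
  cases x with
  | new => exact h
  | old x => rfl

end Ty

/-! ### Substitution in terms -/

namespace TyCon

theorem subst_up_up {V W U : Kind → Type} {κ : Kind} (θ : ∀ κ', V κ' → TyCon W κ')
    (η : ∀ κ', W κ' → TyCon U κ') :
    (fun κ' (x : Ext V κ κ') => subst (up η) (up θ κ' x))
      = up (fun κ' x => subst η (θ κ' x)) := by
  funext κ' x
  cases x with
  | new => rfl
  | old x => simp [up, subst_rename, rename_subst]

theorem up_var {V : Kind → Type} {κ : Kind} :
    up (κ := κ) (fun κ' (x : V κ') => var x) = fun _ x => var x := by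
  funext κ' x; cases x <;> rfl

/-- The substitution `θ` extended by the value `τ` for the newest variable. -/
def cons {V W : Kind → Type} {κ : Kind} (θ : ∀ κ', V κ' → TyCon W κ') (τ : TyCon W κ) :
    ∀ κ', Ext V κ κ' → TyCon W κ'
  | _, .new => τ
  | _, .old x => θ _ x

theorem subst_single_up {V W : Kind → Type} {κ : Kind} (θ : ∀ κ', V κ' → TyCon W κ')
    (τ : TyCon W κ) :
    (fun κ' (x : Ext V κ κ') => subst (single τ) (up θ κ' x)) = cons θ τ := by
  funext κ' x
  cases x with
  | new => rfl
  | old x => rw [up, subst_rename]; exact subst_var _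

theorem inst_subst_up {V W : Kind → Type} {κ κ' : Kind} (φ : TyCon (Ext V κ) κ')
    (θ : ∀ κ', V κ' → TyCon W κ') (τ : TyCon W κ) :
    inst (subst (up θ) φ) τ = subst (cons θ τ) φ := by
  rw [inst, subst_subst, subst_single_up]

end TyCon

namespace Term

theorem rename_rename {V : Kind → Type} {X : Type} (s : Term V X) : ∀ {Y Z : Type} (f : X → Y)
    (g : Y → Z), rename g (rename f s) = rename (fun x => g (f x)) s := by
  have key : ∀ {X Y Z : Type} (f : X → Y) (g : Y → Z),
      (fun x => Option.map g (Option.map f x)) = Option.map (fun x => g (f x)) := by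
    intro X Y Z f g; funext x; cases x <;> rfl
  induction s with
  | var x => intros; rfl
  | sym c => intros; rfl
  | lam σ s ih => intros; simp only [rename, ih, key]
  | app s t ihs iht => intros; simp [rename, ihs, iht]
  | tlam κ s ih => intros; simp [rename, ih]
  | tapp s τ ih => intros; simp [rename, ih]

theorem subst_rename {V : Kind → Type} {X : Type} (s : Term V X) : ∀ {Y Z : Type} (f : X → Y)
    (γ : Y → Term V Z), subst γ (rename f s) = subst (fun x => γ (f x)) s := by
  have key : ∀ {V : Kind → Type} {X Y Z : Type} (f : X → Y) (γ : Y → Term V Z),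
      (fun x => up γ (Option.map f x)) = up (fun x => γ (f x)) := by
    intro V X Y Z f γ; funext x; cases x <;> rfl
  induction s with
  | var x => intros; rfl
  | sym c => intros; rfl
  | lam σ s ih => intros; simp [rename, subst, ih, key]
  | app s t ihs iht => intros; simp [rename, subst, ihs, iht]
  | tlam κ s ih => intros; simp [rename, subst, ih]
  | tapp s τ ih => intros; simp [rename, subst, ih]

theorem tsubst_rename {V : Kind → Type} {X : Type} (s : Term V X) : ∀ {W : Kind → Type}
    {Y : Type} (f : X → Y) (θ : ∀ κ, V κ → TyCon W κ),
    tsubst θ (rename f s) = rename f (tsubst θ s) := by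
  induction s with
  | var x => intros; rfl
  | sym c => intros; rfl
  | lam σ s ih => intros; simp [rename, tsubst, ih]
  | app s t ihs iht => intros; simp [rename, tsubst, ihs, iht]
  | tlam κ s ih => intros; simp [rename, tsubst, ih]
  | tapp s τ ih => intros; simp [rename, tsubst, ih]

theorem rename_subst {V : Kind → Type} {X : Type} (s : Term V X) : ∀ {Y Z : Type}
    (γ : X → Term V Y) (f : Y → Z),
    rename f (subst γ s) = subst (fun x => rename f (γ x)) s := by
  have key : ∀ {V : Kind → Type} {X Y Z : Type} (γ : X → Term V Y) (f : Y → Z),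
      (fun x => rename (Option.map f) (up γ x)) = up (fun x => rename f (γ x)) := by
    intro V X Y Z γ f; funext x
    cases x with
    | none => rfl
    | some x => simp [up, weaken, rename_rename]
  induction s with
  | var x => intros; rfl
  | sym c => intros; rfl
  | lam σ s ih => intros; simp [rename, subst, ih, key]
  | app s t ihs iht => intros; simp [rename, subst, ihs, iht]
  | tlam κ s ih => intros; simp [rename, subst, ih, tweaken, tsubst_rename]
  | tapp s τ ih => intros; simp [rename, subst, ih]

theorem tsubst_tsubst {V : Kind → Type} {X : Type} (s : Term V X) : ∀ {W U : Kind → Type}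
    (θ : ∀ κ, V κ → TyCon W κ) (η : ∀ κ, W κ → TyCon U κ),
    tsubst η (tsubst θ s) = tsubst (fun κ x => (θ κ x).subst η) s := by
  induction s with
  | var x => intros; rfl
  | sym c => intros; rfl
  | lam σ s ih => intros; simp [tsubst, ih, Ty.subst_subst]
  | app s t ihs iht => intros; simp [tsubst, ihs, iht]
  | tlam κ s ih => intros; simp [tsubst, ih, TyCon.subst_up_up]
  | tapp s τ ih => intros; simp [tsubst, ih, Ty.subst_subst]

theorem tweaken_tsubst {V W : Kind → Type} {X : Type} {κ : Kind} (s : Term V X)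
    (θ : ∀ κ, V κ → TyCon W κ) :
    tsubst (TyCon.up θ) (s.tweaken κ) = (tsubst θ s).tweaken κ := by
  rw [tweaken, tweaken, tsubst_tsubst, tsubst_tsubst]
  congr 1
  funext κ' x
  exact TyCon.rename_eq_subst _ _

theorem tsubst_subst {V : Kind → Type} {X : Type} (s : Term V X) : ∀ {W : Kind → Type}
    {Y : Type} (γ : X → Term V Y) (θ : ∀ κ, V κ → TyCon W κ),
    tsubst θ (subst γ s) = subst (fun x => tsubst θ (γ x)) (tsubst θ s) := by
  have key : ∀ {V W : Kind → Type} {X Y : Type} (γ : X → Term V Y) (θ : ∀ κ, V κ → TyCon W κ),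
      (fun x => tsubst θ (up γ x)) = up (fun x => tsubst θ (γ x)) := by
    intro V W X Y γ θ; funext x
    cases x with
    | none => rfl
    | some x => simp [up, weaken, tsubst_rename]
  induction s with
  | var x => intros; rfl
  | sym c => intros; rfl
  | lam σ s ih => intros; simp [tsubst, subst, ih, key]
  | app s t ihs iht => intros; simp [tsubst, subst, ihs, iht]
  | tlam κ s ih => intros; simp [tsubst, subst, ih, tweaken_tsubst]
  | tapp s τ ih => intros; simp [tsubst, subst, ih]

theorem subst_subst {V : Kind → Type} {X : Type} (s : Term V X) : ∀ {Y Z : Type}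
    (γ : X → Term V Y) (δ : Y → Term V Z),
    subst δ (subst γ s) = subst (fun x => subst δ (γ x)) s := by
  have key : ∀ {V : Kind → Type} {X Y Z : Type} (γ : X → Term V Y) (δ : Y → Term V Z),
      (fun x => subst (up δ) (up γ x)) = up (fun x => subst δ (γ x)) := by
    intro V X Y Z γ δ; funext x
    cases x with
    | none => rfl
    | some x => simp [up, weaken, subst_rename, rename_subst]
  induction s with
  | var x => intros; rfl
  | sym c => intros; rfl
  | lam σ s ih => intros; simp [subst, ih, key]
  | app s t ihs iht => intros; simp [subst, ihs, iht]
  | tlam κ s ih => intros; simp [subst, ih, tweaken, tsubst_subst]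
  | tapp s τ ih => intros; simp [subst, ih]

theorem subst_var {V : Kind → Type} {X : Type} (s : Term V X) : subst var s = s := by
  have key : ∀ {V : Kind → Type} {X : Type}, up (var (V := V) (X := X)) = var := by
    intro V X; funext x; cases x <;> rfl
  have key' : ∀ {V : Kind → Type} {X : Type} {κ : Kind},
      (fun x => tweaken κ (var (V := V) (X := X) x)) = var := by
    intro V X κ; rfl
  induction s with
  | var x => rfl
  | sym c => rfl
  | lam σ s ih => simp [subst, ih, key]
  | app s t ihs iht => simp [subst, ihs, iht]
  | tlam κ s ih => simp [subst, ih, key']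
  | tapp s τ ih => simp [subst, ih]

theorem tsubst_var {V : Kind → Type} {X : Type} (s : Term V X) :
    tsubst (fun _ x => .var x) s = s := by
  induction s with
  | var x => rfl
  | sym c => rfl
  | lam σ s ih => simp [tsubst, ih, Ty.subst_var]
  | app s t ihs iht => simp [tsubst, ihs, iht]
  | tlam κ s ih => simp [tsubst, ih, TyCon.up_var]
  | tapp s τ ih => simp [tsubst, ih, Ty.subst_var]

theorem weaken_inst {V : Kind → Type} {X : Type} (s t : Term V X) : s.weaken.inst t = s := by
  rw [weaken, inst, subst_rename]
  exact subst_var s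

theorem tweaken_tinst {V : Kind → Type} {X : Type} {κ : Kind} (s : Term V X) (τ : TyCon V κ) :
    (s.tweaken κ).tinst τ = s := by
  rw [tweaken, tinst, tsubst_tsubst]
  exact tsubst_var s

theorem inst_subst_up {V : Kind → Type} {X Y : Type} (s : Term V (Option X))
    (γ : X → Term V Y) (t : Term V Y) :
    (subst (up γ) s).inst t = subst (fun o => o.elim t γ) s := by
  rw [inst, subst_subst]
  congr 1
  funext o
  cases o with
  | none => rfl
  | some x => exact weaken_inst (γ x) t

theorem tinst_subst_tsubst_up {V W : Kind → Type} {X Y : Type} {κ : Kind} (s : Term (Ext V κ) X)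
    (θ : ∀ κ, V κ → TyCon W κ) (γ : X → Term W Y) (τ : TyCon W κ) :
    (subst (fun x => (γ x).tweaken κ) (tsubst (TyCon.up θ) s)).tinst τ
      = subst γ (tsubst (TyCon.cons θ τ) s) := by
  rw [tinst, tsubst_subst, tsubst_tsubst, TyCon.subst_single_up]
  congr 1
  funext x
  exact tweaken_tinst (γ x) τ

end Term

/-! ### Typing -/

theorem Ty.subst_up_old_inst_new {V : Kind → Type} {κ κ' : Kind} (σ : Ty (Ext V κ) κ') :
    (σ.subst (TyCon.up fun _ x => TyCon.var (Ext.old x))).inst (TyCon.var (Ext.new (κ := κ)))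
      = σ := by
  rw [Ty.inst, Ty.subst_subst, TyCon.subst_single_up]
  refine Eq.trans ?_ (Ty.subst_var σ)
  congr 1
  funext κ'' x
  cases x <;> rfl

theorem Sym.type_subst {V W : Kind → Type} (f : Sym) (θ : ∀ κ', V κ' → TyCon W κ') :
    (f.type (V := V)).subst θ = f.type := by
  cases f <;> rfl

/-- The type of a polymorphic function symbol, without its outer quantifier. -/
def Sym.body {V : Kind → Type} : Sym → TyCon (Ext V .star) .star
  | .num _ => .nat
  | .plus => .arrow (.var .new) (.arrow (.var .new) (.var .new))
  | .times => .arrow (.var .new) (.arrow (.var .new) (.var .new))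
  | .flatten => .arrow (.var .new) .nat
  | .lift => .arrow .nat (.var .new)

theorem Sym.type_eq_all {V : Kind → Type} {f : Sym} (hf : ∀ n, f ≠ .num n) :
    f.type (V := V) = .all .star f.body := by
  cases f <;> first | rfl | exact (hf _ rfl).elim

namespace HasType

open Term (circ flatten lift num)

theorem rename {V : Kind → Type} {X : Type} {Γ : X → Ty V .star} {s : Term V X} {σ : Ty V .star}
    (h : HasType Γ s σ) : ∀ {Y : Type} (f : X → Y) (Δ : Y → Ty V .star),
    (∀ x, Δ (f x) = Γ x) → HasType Δ (s.rename f) σ := by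
  induction h with
  | var x => intro Y f Δ hf; rw [← hf]; exact .var _
  | sym c => intros; exact .sym c
  | lam _ ih =>
    intro Y f Δ hf
    refine .lam (ih _ _ fun x => ?_)
    cases x with
    | none => rfl
    | some x => exact hf x
  | app _ _ ihs iht => intro Y f Δ hf; exact .app (ihs f Δ hf) (iht f Δ hf)
  | tlam _ ih => intro Y f Δ hf; exact .tlam (ih f _ fun x => by rw [hf])
  | tapp τ _ ih => intro Y f Δ hf; exact .tapp τ (ih f Δ hf)

theorem weaken {V : Kind → Type} {X : Type} {Γ : X → Ty V .star} {s : Term V X} {σ τ : Ty V .star}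
    (h : HasType Γ s σ) : HasType (extEnv Γ τ) s.weaken σ :=
  h.rename _ _ fun _ => rfl

theorem tsubst {V : Kind → Type} {X : Type} {Γ : X → Ty V .star} {s : Term V X} {σ : Ty V .star}
    (h : HasType Γ s σ) : ∀ {W : Kind → Type} (θ : ∀ κ, V κ → TyCon W κ),
    HasType (fun x => (Γ x).subst θ) (s.tsubst θ) (σ.subst θ) := by
  induction h with
  | var x => intro W θ; exact .var (Γ := fun x => Ty.subst θ _) x
  | sym f =>
    intro W θ
    change HasType _ (.sym f) (Ty.mk (f.type.subst θ))
    rw [Sym.type_subst]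
    exact .sym f
  | lam _ ih =>
    intro W θ
    rw [Ty.subst_arrow]
    refine .lam ?_
    convert ih θ using 1
    funext x
    cases x <;> rfl
  | app _ _ ihs iht => intro W θ; exact .app (Ty.subst_arrow _ _ θ ▸ ihs θ) (iht θ)
  | tlam _ ih =>
    intro W θ
    rw [Ty.subst_all]
    refine .tlam ?_
    simpa only [Ty.weaken_subst] using ih (TyCon.up θ)
  | tapp τ _ ih =>
    intro W θ
    rw [Ty.subst_inst]
    exact .tapp _ (Ty.subst_all _ θ ▸ ih θ)

theorem tweaken {V : Kind → Type} {X : Type} {Γ : X → Ty V .star} {s : Term V X}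
    {σ : Ty V .star} (κ : Kind) (h : HasType Γ s σ) :
    HasType (fun x => (Γ x).weaken κ) (s.tweaken κ) (σ.weaken κ) :=
  h.tsubst _

theorem tinst {V : Kind → Type} {X : Type} {Γ : X → Ty V .star} {κ : Kind}
    {s : Term (Ext V κ) X} {σ : Ty (Ext V κ) .star} (h : HasType (fun x => (Γ x).weaken κ) s σ)
    (τ : TyCon V κ) : HasType Γ (s.tinst τ) (σ.inst τ) := by
  have h' := h.tsubst (TyCon.single τ)
  have e : (fun x => ((Γ x).weaken κ).subst (TyCon.single τ)) = Γ :=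
    funext fun x => Ty.weaken_inst (Γ x) τ
  rwa [e] at h'

theorem subst {V : Kind → Type} {X : Type} {Γ : X → Ty V .star} {s : Term V X} {σ : Ty V .star}
    (h : HasType Γ s σ) : ∀ {Y : Type} {Δ : Y → Ty V .star} {γ : X → Term V Y},
    (∀ x, HasType Δ (γ x) (Γ x)) → HasType Δ (s.subst γ) σ := by
  induction h with
  | var x => intro Y Δ γ hγ; exact hγ x
  | sym f => intros; exact .sym f
  | lam _ ih =>
    intro Y Δ γ hγ
    refine .lam (ih fun x => ?_)
    cases x with
    | none => exact .var none
    | some x => exact (hγ x).weaken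
  | app _ _ ihs iht => intro Y Δ γ hγ; exact .app (ihs hγ) (iht hγ)
  | tlam _ ih => intro Y Δ γ hγ; exact .tlam (ih fun x => (hγ x).tweaken _)
  | tapp τ _ ih => intro Y Δ γ hγ; exact .tapp τ (ih hγ)

theorem inst {V : Kind → Type} {X : Type} {Γ : X → Ty V .star} {s : Term V (Option X)}
    {t : Term V X} {σ τ : Ty V .star} (hs : HasType (extEnv Γ σ) s τ) (ht : HasType Γ t σ) :
    HasType Γ (s.inst t) τ := by
  refine hs.subst fun x => ?_
  cases x with
  | none => exact ht
  | some x => exact .var x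

section Inversion

variable {V : Kind → Type} {X : Type} {Γ : X → Ty V .star} {ρ : Ty V .star}

theorem sym_inv {f : Sym} (h : HasType Γ (.sym f) ρ) : ρ = Ty.mk f.type := by
  cases h; rfl

theorem lam_inv {σ : Ty V .star} {s : Term V (Option X)} (h : HasType Γ (.lam σ s) ρ) :
    ∃ τ, ρ = Ty.arrow σ τ ∧ HasType (extEnv Γ σ) s τ := by
  cases h with | lam h => exact ⟨_, rfl, h⟩

theorem tlam_inv {κ : Kind} {s : Term (Ext V κ) X} (h : HasType Γ (.tlam κ s) ρ) :
    ∃ σ, ρ = Ty.all κ σ ∧ HasType (fun x => (Γ x).weaken κ) s σ := by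
  cases h with | tlam h => exact ⟨_, rfl, h⟩

theorem app_inv {s t : Term V X} (h : HasType Γ (.app s t) ρ) :
    ∃ σ, HasType Γ s (Ty.arrow σ ρ) ∧ HasType Γ t σ := by
  cases h with | app hs ht => exact ⟨_, hs, ht⟩

theorem tapp_inv {κ : Kind} {s : Term V X} {T : Ty V κ} (h : HasType Γ (.tapp s T) ρ) :
    ∃ σ τ, T = Ty.mk τ ∧ ρ = σ.inst τ ∧ HasType Γ s (Ty.all κ σ) := by
  cases h with | tapp τ h => exact ⟨_, τ, rfl, rfl, h⟩

end Inversion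

/-- The type of a polymorphic function symbol at the instance `T`. -/
def instType {V : Kind → Type} : Sym → Ty V .star → Ty V .star
  | .num _, _ => Ty.nat
  | .plus, T => Ty.arrow T (Ty.arrow T T)
  | .times, T => Ty.arrow T (Ty.arrow T T)
  | .flatten, T => Ty.arrow T Ty.nat
  | .lift, T => Ty.arrow Ty.nat T

section Symbols

variable {V : Kind → Type} {X : Type} {Γ : X → Ty V .star} {ρ T : Ty V .star}

theorem tapp_sym {f : Sym} (hf : ∀ n, f ≠ .num n) :
    HasType Γ (.tapp (.sym f) T) (instType f T) := by
  obtain ⟨τ, rfl⟩ := Ty.exists_mk T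
  have h := HasType.sym (Γ := Γ) f
  rw [Sym.type_eq_all hf] at h
  have h := HasType.tapp (σ := Ty.mk f.body) τ h
  cases f <;> exact h

theorem tapp_sym_inv {f : Sym} (h : HasType Γ (.tapp (.sym f) T) ρ) :
    (∀ n, f ≠ .num n) ∧ ρ = instType f T := by
  obtain ⟨σ, τ, rfl, rfl, h'⟩ := h.tapp_inv
  have h := h'.sym_inv
  have hf : ∀ n, f ≠ .num n := by
    rintro n rfl
    exact Ty.nat_ne_all h.symm
  rw [Sym.type_eq_all hf] at h
  cases Ty.all_inj (σ' := Ty.mk f.body) h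
  cases f <;> exact ⟨hf, rfl⟩

theorem circ {c : Sym} (hc : c = .plus ∨ c = .times) {s t : Term V X} (hs : HasType Γ s T)
    (ht : HasType Γ t T) : HasType Γ (circ c T s t) T := by
  rcases hc with rfl | rfl <;> exact .app (.app (tapp_sym nofun) hs) ht

theorem circ_inv {c : Sym} (hc : c = .plus ∨ c = .times) {s t : Term V X}
    (h : HasType Γ (Term.circ c T s t) ρ) : ρ = T ∧ HasType Γ s T ∧ HasType Γ t T := by
  obtain ⟨σ₁, h, ht⟩ := h.app_inv
  obtain ⟨σ₂, h, hs⟩ := h.app_inv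
  have h := h.tapp_sym_inv.2
  have h : Ty.arrow σ₂ (Ty.arrow σ₁ ρ) = Ty.arrow T (Ty.arrow T T) := by
    rcases hc with rfl | rfl <;> exact h
  obtain ⟨rfl, h⟩ := Ty.arrow_inj h
  obtain ⟨rfl, rfl⟩ := Ty.arrow_inj h
  exact ⟨rfl, hs, ht⟩

theorem flatten {s : Term V X} (hs : HasType Γ s T) : HasType Γ (flatten T s) Ty.nat :=
  .app (tapp_sym (f := .flatten) nofun) hs

theorem flatten_inv {s : Term V X} (h : HasType Γ (Term.flatten T s) ρ) :
    ρ = Ty.nat ∧ HasType Γ s T := by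
  obtain ⟨σ, h, hs⟩ := h.app_inv
  obtain ⟨rfl, rfl⟩ := Ty.arrow_inj (h.tapp_sym_inv.2 : _ = Ty.arrow T Ty.nat)
  exact ⟨rfl, hs⟩

theorem lift {s : Term V X} (hs : HasType Γ s Ty.nat) : HasType Γ (lift T s) T :=
  .app (tapp_sym (f := .lift) nofun) hs

theorem lift_inv {s : Term V X} (h : HasType Γ (Term.lift T s) ρ) :
    ρ = T ∧ HasType Γ s Ty.nat := by
  obtain ⟨σ, h, hs⟩ := h.app_inv
  obtain ⟨rfl, rfl⟩ := Ty.arrow_inj (h.tapp_sym_inv.2 : _ = Ty.arrow Ty.nat T)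
  exact ⟨rfl, hs⟩

theorem num (n : ℕ) : HasType Γ (num n) Ty.nat := .sym (.num n)

theorem tapp_new {κ : Kind} {σ : Ty (Ext V κ) .star} {s : Term V X}
    (hs : HasType Γ s (Ty.all κ σ)) :
    HasType (fun x => (Γ x).weaken κ) (.tapp (s.tweaken κ) (Ty.mk (.var .new))) σ := by
  have h := hs.tweaken κ
  rw [Ty.weaken, Ty.subst_all] at h
  have h := HasType.tapp (.var .new) h
  rwa [Ty.subst_up_old_inst_new] at h

end Symbols

theorem unique {V : Kind → Type} {X : Type} {Γ : X → Ty V .star} {s : Term V X} {σ : Ty V .star}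
    (h : HasType Γ s σ) : ∀ {τ : Ty V .star}, HasType Γ s τ → σ = τ := by
  induction h with
  | var x => intro τ h; cases h; rfl
  | sym f => intro τ h; exact h.sym_inv.symm
  | lam _ ih =>
    intro τ h
    obtain ⟨τ', rfl, h'⟩ := h.lam_inv
    rw [ih h']
  | app _ _ ihs _ =>
    intro τ h
    obtain ⟨σ', hs, -⟩ := h.app_inv
    exact (Ty.arrow_inj (ihs hs)).2
  | tlam _ ih =>
    intro τ h
    obtain ⟨σ', rfl, h'⟩ := h.tlam_inv
    rw [ih h']
  | tapp τ _ ih =>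
    intro τ' h
    obtain ⟨σ', τ'', e, rfl, h'⟩ := h.tapp_inv
    rw [Ty.all_inj (ih h'), Ty.inst_congr _ e]

end HasType

/-- Subject reduction. -/
theorem HasType.step {V : Kind → Type} {X : Type} {s t : Term V X} (hst : Term.Step s t) :
    ∀ {Γ : X → Ty V .star} {ρ : Ty V .star}, HasType Γ s ρ → HasType Γ t ρ := by
  induction hst with
  | lam σ _ ih => intro Γ ρ h; obtain ⟨τ, rfl, h'⟩ := h.lam_inv; exact .lam (ih h')
  | tlam _ ih => intro Γ ρ h; obtain ⟨τ, rfl, h'⟩ := h.tlam_inv; exact .tlam (ih h')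
  | app_right u _ ih => intro Γ ρ h; obtain ⟨σ, hs, ht⟩ := h.app_inv; exact .app hs (ih ht)
  | app_left u _ ih => intro Γ ρ h; obtain ⟨σ, hs, ht⟩ := h.app_inv; exact .app (ih hs) ht
  | tapp T _ ih => intro Γ ρ h; obtain ⟨σ, τ, rfl, rfl, h'⟩ := h.tapp_inv; exact .tapp _ (ih h')
  | beta σ s t =>
    intro Γ ρ h
    obtain ⟨σ', hs, ht⟩ := h.app_inv
    obtain ⟨τ, e, hs⟩ := hs.lam_inv
    obtain ⟨rfl, rfl⟩ := Ty.arrow_inj e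
    exact hs.inst ht
  | tbeta s τ =>
    intro Γ ρ h
    obtain ⟨σ, τ', e, rfl, h'⟩ := h.tapp_inv
    obtain ⟨σ', e', hs⟩ := h'.tlam_inv
    cases Ty.all_inj e'
    rw [← Ty.inst_congr σ e]
    exact hs.tinst τ
  | plus_nat n m => intro Γ ρ h; obtain ⟨rfl, -, -⟩ := h.circ_inv (.inl rfl); exact .num _
  | times_nat n m => intro Γ ρ h; obtain ⟨rfl, -, -⟩ := h.circ_inv (.inr rfl); exact .num _
  | circ_arrow c hc σ τ s t =>
    intro Γ ρ h
    obtain ⟨rfl, hs, ht⟩ := h.circ_inv hc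
    exact .lam (.circ hc (.app hs.weaken (.var none)) (.app ht.weaken (.var none)))
  | circ_all c hc κ σ s t =>
    intro Γ ρ h
    obtain ⟨rfl, hs, ht⟩ := h.circ_inv hc
    exact .tlam (.circ hc hs.tapp_new ht.tapp_new)
  | flatten_nat s => intro Γ ρ h; obtain ⟨rfl, h'⟩ := h.flatten_inv; exact h'
  | flatten_arrow σ τ s =>
    intro Γ ρ h
    obtain ⟨rfl, h'⟩ := h.flatten_inv
    exact .flatten (.app h' (.lift (.num 0)))
  | flatten_all κ σ s =>
    intro Γ ρ h
    obtain ⟨rfl, h'⟩ := h.flatten_inv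
    exact .flatten (.tapp _ h')
  | lift_nat s => intro Γ ρ h; obtain ⟨rfl, h'⟩ := h.lift_inv; exact h'
  | lift_arrow σ τ s =>
    intro Γ ρ h
    obtain ⟨rfl, h'⟩ := h.lift_inv
    exact .lam (.lift h'.weaken)
  | lift_all κ σ s =>
    intro Γ ρ h
    obtain ⟨rfl, h'⟩ := h.lift_inv
    exact .tlam (.lift (h'.tweaken κ))

theorem HasType.steps {V : Kind → Type} {X : Type} {s t : Term V X}
    (hst : Relation.ReflTransGen Term.Step s t) {Γ : X → Ty V .star} {ρ : Ty V .star}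
    (h : HasType Γ s ρ) : HasType Γ t ρ := by
  induction hst with
  | refl => exact h
  | tail _ h' ih => exact ih.step h'

/-! ### Closed normal forms -/

/-- The possible shapes of a closed term in normal form of a given type. -/
inductive ClosedValue {V : Kind → Type} {X : Type} : Term V X → Ty V .star → Prop
  | num (n : ℕ) : ClosedValue (.num n) Ty.nat
  | lam (σ τ : Ty V .star) (s : Term V (Option X)) : ClosedValue (.lam σ s) (Ty.arrow σ τ)
  | tlam (κ : Kind) (σ : Ty (Ext V κ) .star) (s : Term (Ext V κ) X) :
      ClosedValue (.tlam κ s) (Ty.all κ σ)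
  | sym (f : Sym) (σ : Ty (Ext V .star) .star) : ClosedValue (.sym f) (Ty.all .star σ)
  | tapp_sym (f : Sym) (T σ τ : Ty V .star) : ClosedValue (.tapp (.sym f) T) (Ty.arrow σ τ)
  | circ_partial (c : Sym) (hc : c = .plus ∨ c = .times) (T σ τ : Ty V .star) (s : Term V X)
      (hs : T = Ty.nat → ∃ n, s = .num n) :
      ClosedValue (.app (.tapp (.sym c) T) s) (Ty.arrow σ τ)

theorem ClosedValue.eq_num {V : Kind → Type} {X : Type} {s : Term V X}
    (h : ClosedValue s Ty.nat) : ∃ n, s = .num n := by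
  generalize e : Ty.nat = ρ at h
  cases h with
  | num n => exact ⟨n, rfl⟩
  | lam => exact (Ty.nat_ne_arrow e).elim
  | tlam => exact (Ty.nat_ne_all e).elim
  | sym => exact (Ty.nat_ne_all e).elim
  | tapp_sym => exact (Ty.nat_ne_arrow e).elim
  | circ_partial => exact (Ty.nat_ne_arrow e).elim

theorem HasType.closedValue {V : Kind → Type} {X : Type} {Γ : X → Ty V .star} {s : Term V X}
    {σ : Ty V .star} (h : HasType Γ s σ) (hV : ∀ κ, IsEmpty (V κ)) (hX : IsEmpty X)
    (hs : s.IsNormal) : ClosedValue s σ := by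
  induction h with
  | var x => exact (hX.false x).elim
  | sym f =>
    cases f with
    | num n => exact .num n
    | plus => exact .sym _ (Ty.mk _)
    | times => exact .sym _ (Ty.mk _)
    | flatten => exact .sym _ (Ty.mk _)
    | lift => exact .sym _ (Ty.mk _)
  | lam => exact .lam _ _ _
  | tlam => exact .tlam _ _ _
  | @app V X Γ σ τ s t h₁ h₂ ihs iht =>
    have ihs := ihs hV hX fun s' h => hs _ (.app_left _ h)
    have iht := iht hV hX fun s' h => hs _ (.app_right _ h)
    generalize e : Ty.arrow σ τ = ρ at ihs
    cases ihs with
    | num n => exact (Ty.nat_ne_arrow e.symm).elim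
    | tlam => exact (Ty.arrow_ne_all e).elim
    | sym => exact (Ty.arrow_ne_all e).elim
    | lam => exact (hs _ (.beta _ _ _)).elim
    | tapp_sym f T =>
      obtain ⟨hf, e'⟩ := h₁.tapp_sym_inv
      cases f with
      | num n => exact (hf n rfl).elim
      | plus =>
        obtain ⟨rfl, rfl⟩ := Ty.arrow_inj e'
        exact .circ_partial _ (.inl rfl) _ _ _ _ fun h => ClosedValue.eq_num (h ▸ iht)
      | times =>
        obtain ⟨rfl, rfl⟩ := Ty.arrow_inj e'
        exact .circ_partial _ (.inr rfl) _ _ _ _ fun h => ClosedValue.eq_num (h ▸ iht)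
      | flatten =>
        rcases Ty.closed_cases hV T with rfl | ⟨a, b, rfl⟩ | ⟨κ, a, rfl⟩
        · exact (hs _ (.flatten_nat _)).elim
        · exact (hs _ (.flatten_arrow _ _ _)).elim
        · exact (hs _ (.flatten_all _ _ _)).elim
      | lift =>
        rcases Ty.closed_cases hV T with rfl | ⟨a, b, rfl⟩ | ⟨κ, a, rfl⟩
        · exact (hs _ (.lift_nat _)).elim
        · exact (hs _ (.lift_arrow _ _ _)).elim
        · exact (hs _ (.lift_all _ _ _)).elim
    | circ_partial c hc T _ _ a ha =>
      rcases Ty.closed_cases hV T with rfl | ⟨a, b, rfl⟩ | ⟨κ, a, rfl⟩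
      · obtain ⟨n, rfl⟩ := ha rfl
        obtain ⟨-, -, h₄⟩ := (HasType.app h₁ h₂).circ_inv hc
        cases h₂.unique h₄
        obtain ⟨m, rfl⟩ := iht.eq_num
        rcases hc with rfl | rfl
        · exact (hs _ (.plus_nat n m)).elim
        · exact (hs _ (.times_nat n m)).elim
      · exact (hs _ (.circ_arrow _ hc _ _ _ _)).elim
      · exact (hs _ (.circ_all _ hc _ _ _ _)).elim
  | @tapp V X Γ κ σ s τ h₁ ih =>
    have ih := ih hV hX fun s' h => hs _ (.tapp _ h)
    generalize e : Ty.all κ σ = ρ at ih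
    cases ih with
    | num n => exact (Ty.nat_ne_all e.symm).elim
    | tlam => cases Ty.all_kind_inj e; exact (hs _ (.tbeta _ _)).elim
    | lam => exact (Ty.arrow_ne_all e.symm).elim
    | tapp_sym => exact (Ty.arrow_ne_all e.symm).elim
    | circ_partial => exact (Ty.arrow_ne_all e.symm).elim
    | sym f =>
      cases Ty.all_kind_inj e
      obtain ⟨hf, e'⟩ := (HasType.tapp τ h₁).tapp_sym_inv
      rw [e']
      cases f with
      | num n => exact (hf n rfl).elim
      | plus => exact .tapp_sym _ _ _ _
      | times => exact .tapp_sym _ _ _ _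
      | flatten => exact .tapp_sym _ _ _ _
      | lift => exact .tapp_sym _ _ _ _

/-! ### Reducibility -/

/-- `s` reduces to a numeral. -/
def Evaluates {V : Kind → Type} {X : Type} (s : Term V X) : Prop :=
  ∃ n, Relation.ReflTransGen Term.Step s (.num n)

theorem Evaluates.expand {V : Kind → Type} {X : Type} {s t : Term V X} (h : Term.Step s t)
    (ht : Evaluates t) : Evaluates s :=
  ht.imp fun _ hn => .head h hn

theorem Evaluates.circ {V : Kind → Type} {X : Type} {c : Sym} (hc : c = .plus ∨ c = .times)
    {s t : Term V X} (hs : Evaluates s) (ht : Evaluates t) :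
    Evaluates (.circ c Ty.nat s t) := by
  obtain ⟨n, hn⟩ := hs
  obtain ⟨m, hm⟩ := ht
  have h : Relation.ReflTransGen Term.Step (Term.circ c Ty.nat s t)
      (.circ c Ty.nat (.num n) (.num m)) :=
    (hn.lift (fun a => Term.circ c Ty.nat a t) fun _ _ h => .app_left _ (.app_right _ h)).trans
      (hm.lift (fun b => Term.circ c Ty.nat (.num n) b) fun _ _ h => .app_right _ h)
  rcases hc with rfl | rfl
  · exact ⟨_, h.tail (.plus_nat n m)⟩
  · exact ⟨_, h.tail (.times_nat n m)⟩

/-- Candidates for the closed type `σ`: sets of closed raw terms that are closed under expansion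
and under the function symbols at `σ`. -/
structure IsCandidate (σ : Ty NoVar .star) (R : ClosedTerm → Prop) : Prop where
  expand : ∀ {s t}, Term.Step s t → R t → R s
  flatten : ∀ {s}, R s → Evaluates (Term.flatten σ s)
  lift : ∀ {s}, Evaluates s → R (Term.lift σ s)
  circ : ∀ {c s t}, c = Sym.plus ∨ c = Sym.times → R s → R t → R (Term.circ c σ s t)

/-- `Valid κ φ a`: the semantic value `a` is an admissible value of the closed constructor `φ`;
at kind `*` it is a candidate, and at arrow kinds it preserves admissibility. -/
def Valid : (κ : Kind) → TyCon NoVar κ → Sem (ClosedTerm → Prop) κ → Prop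
  | .star, σ, R => IsCandidate (Ty.mk σ) R
  | .arr κ₁ κ₂, φ, F => ∀ (ψ : TyCon NoVar κ₁) (a : Sem (ClosedTerm → Prop) κ₁),
      Valid κ₁ ψ a → Valid κ₂ (φ.app ψ) ((F : Sem (ClosedTerm → Prop) κ₁ → Sem _ κ₂) a)

/-- The reducibility model. A quantified type is interpreted by quantification over all closed
constructors together with all of their admissible values. -/
def redModel : TyModel (ClosedTerm → Prop) where
  nat := Evaluates
  arrow R S s := ∀ t, R t → S (.app s t)
  all κ F s := ∀ (τ : TyCon NoVar κ) (a : Sem (ClosedTerm → Prop) κ), Valid κ τ a →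
    F a (.tapp s (Ty.mk τ))

theorem Valid.congr : ∀ {κ : Kind} {φ φ' : TyCon NoVar κ} {a : Sem (ClosedTerm → Prop) κ},
    Ty.mk φ = Ty.mk φ' → Valid κ φ a → Valid κ φ' a
  | .star, _, _, _, e, h => by rw [Valid] at h ⊢; rwa [← e]
  | .arr _ _, _, _, _, e, h => fun ψ a hψ => Valid.congr (Ty.mk_app_congr e rfl) (h ψ a hψ)

theorem isCandidate_nat : IsCandidate Ty.nat Evaluates where
  expand := Evaluates.expand
  flatten h := h.expand (.flatten_nat _)
  lift h := h.expand (.lift_nat _)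
  circ hc hs ht := hs.circ hc ht

theorem isCandidate_arrow {σ τ : Ty NoVar .star} {R S : ClosedTerm → Prop} (hR : IsCandidate σ R)
    (hS : IsCandidate τ S) : IsCandidate (Ty.arrow σ τ) (redModel.arrow R S) where
  expand h ht q hq := hS.expand (.app_left _ h) (ht q hq)
  -- `lift_σ 0` is reducible, so it is a legitimate argument.
  flatten h := (hS.flatten (h _ (hR.lift ⟨0, .refl⟩))).expand (.flatten_arrow _ _ _)
  lift {s} h q hq := by
    refine hS.expand (.app_left _ (.lift_arrow _ _ _)) (hS.expand (.beta _ _ _) ?_)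
    have e : (Term.lift τ s.weaken).inst q = Term.lift τ s :=
      congrArg (Term.lift τ) (Term.weaken_inst s q)
    rw [e]
    exact hS.lift h
  circ {c s t} hc hs ht q hq := by
    refine hS.expand (.app_left _ (.circ_arrow _ hc _ _ _ _)) (hS.expand (.beta _ _ _) ?_)
    have e : (Term.circ c τ (.app s.weaken (.var none)) (.app t.weaken (.var none))).inst q
        = Term.circ c τ (.app (s.weaken.inst q) q) (.app (t.weaken.inst q) q) := rfl
    rw [e, Term.weaken_inst, Term.weaken_inst]
    exact hS.circ hc (hs q hq) (ht q hq)

theorem TyCon.subst_chi : ∀ {κ : Kind} {V W : Kind → Type} (θ : ∀ κ', V κ' → TyCon W κ'),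
    (TyCon.chi κ).subst θ = TyCon.chi κ
  | .star, _, _, _ => rfl
  | .arr κ₁ _, _, _, _ => congrArg (TyCon.lam κ₁) (TyCon.subst_chi _)

/-- The canonical admissible value of `χ_κ`. -/
def chiValue : (κ : Kind) → Sem (ClosedTerm → Prop) κ
  | .star => Evaluates
  | .arr _ κ₂ => fun _ => chiValue κ₂

theorem valid_chi : ∀ κ, Valid κ (TyCon.chi κ) (chiValue κ)
  | .star => isCandidate_nat
  | .arr κ₁ κ₂ => fun ψ _ _ => by
    refine Valid.congr (Eq.symm ?_) (valid_chi κ₂)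
    refine (Ty.mk_eq_of_step (TyCon.Step.beta _ ψ)).trans ?_
    rw [TyCon.inst, TyCon.subst_chi]

theorem isCandidate_all {κ : Kind} {σ : Ty (Ext NoVar κ) .star}
    {F : Sem (ClosedTerm → Prop) κ → ClosedTerm → Prop}
    (hF : ∀ τ a, Valid κ τ a → IsCandidate (σ.inst τ) (F a)) :
    IsCandidate (Ty.all κ σ) (redModel.all κ F) where
  expand h ht τ a ha := (hF τ a ha).expand (.tapp _ h) (ht τ a ha)
  flatten h := ((hF _ _ (valid_chi κ)).flatten (h _ _ (valid_chi κ))).expand (.flatten_all _ _ _)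
  lift {s} h τ a ha := by
    have hR := hF τ a ha
    refine hR.expand (.tapp _ (.lift_all _ _ _)) (hR.expand (.tbeta _ _) ?_)
    have e : (Term.lift σ (s.tweaken κ)).tinst τ = Term.lift (σ.inst τ) s :=
      congrArg (Term.lift (σ.inst τ)) (Term.tweaken_tinst s τ)
    rw [e]
    exact hR.lift h
  circ {c s t} hc hs ht τ a ha := by
    have hR := hF τ a ha
    refine hR.expand (.tapp _ (.circ_all _ hc _ _ _ _)) (hR.expand (.tbeta _ _) ?_)
    have e : (Term.circ c σ (.tapp (s.tweaken κ) (Ty.mk (.var .new)))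
          (.tapp (t.tweaken κ) (Ty.mk (.var .new)))).tinst τ
        = Term.circ c (σ.inst τ) (.tapp ((s.tweaken κ).tinst τ) (Ty.mk τ))
          (.tapp ((t.tweaken κ).tinst τ) (Ty.mk τ)) := rfl
    rw [e, Term.tweaken_tinst, Term.tweaken_tinst]
    exact hR.circ hc (hs τ a ha) (ht τ a ha)

theorem valid_cons {V : Kind → Type} {κ : Kind} {θ : ∀ κ', V κ' → TyCon NoVar κ'}
    {ξ : ∀ κ', V κ' → Sem (ClosedTerm → Prop) κ'} (h : ∀ κ' x, Valid κ' (θ κ' x) (ξ κ' x))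
    {τ : TyCon NoVar κ} {a : Sem (ClosedTerm → Prop) κ} (ha : Valid κ τ a) :
    ∀ κ' x, Valid κ' (TyCon.cons θ τ κ' x) (extVal ξ a κ' x) := by
  intro κ' x
  cases x with
  | new => exact ha
  | old x => exact h _ x

/-- The interpretation of a type constructor is an admissible value of its closed instances. -/
theorem valid_eval {V : Kind → Type} {κ : Kind} (φ : TyCon V κ) :
    ∀ {θ : ∀ κ', V κ' → TyCon NoVar κ'} {ξ : ∀ κ', V κ' → Sem (ClosedTerm → Prop) κ'},
    (∀ κ' x, Valid κ' (θ κ' x) (ξ κ' x)) → Valid κ (φ.subst θ) (redModel.eval ξ φ) := by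
  induction φ with
  | var x => intro θ ξ h; exact h _ x
  | nat => intros; exact isCandidate_nat
  | app s t ihs iht => intro θ ξ h; exact ihs h _ _ (iht h)
  | lam κ₁ s ih =>
    intro θ ξ h ψ a ha
    refine Valid.congr ?_ (ih (valid_cons h ha))
    rw [← TyCon.inst_subst_up]
    exact (Ty.mk_eq_of_step (TyCon.Step.beta _ _)).symm
  | all κ s ih =>
    intro θ ξ h
    refine isCandidate_all (σ := Ty.mk (s.subst (TyCon.up θ))) fun τ a ha => ?_
    have h := ih (valid_cons h ha)
    rw [← TyCon.inst_subst_up] at h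
    exact h
  | arrow s t ihs iht => intro θ ξ h; exact isCandidate_arrow (ihs h) (iht h)

theorem isCandidate_tyEval {V : Kind → Type} (σ : Ty V .star) {θ : ∀ κ', V κ' → TyCon NoVar κ'}
    {ξ : ∀ κ', V κ' → Sem (ClosedTerm → Prop) κ'} (h : ∀ κ' x, Valid κ' (θ κ' x) (ξ κ' x)) :
    IsCandidate (σ.subst θ) (redModel.tyEval ξ σ) := by
  obtain ⟨τ, rfl⟩ := Ty.exists_mk σ
  exact valid_eval τ h

/-- The fundamental lemma: closed instances of a typed term by reducible terms are reducible. -/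
theorem HasType.reducible {V : Kind → Type} {X : Type} {Γ : X → Ty V .star} {s : Term V X}
    {σ : Ty V .star} (hs : HasType Γ s σ) :
    ∀ {θ : ∀ κ', V κ' → TyCon NoVar κ'} {ξ : ∀ κ', V κ' → Sem (ClosedTerm → Prop) κ'}
      {γ : X → ClosedTerm}, (∀ κ' x, Valid κ' (θ κ' x) (ξ κ' x)) →
      (∀ x, redModel.tyEval ξ (Γ x) (γ x)) →
      redModel.tyEval ξ σ ((s.tsubst θ).subst γ) := by
  induction hs with
  | var x => intro θ ξ γ h hγ; exact hγ x
  | sym f =>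
    intro θ ξ γ h hγ
    cases f with
    | num n => exact ⟨n, .refl⟩
    | plus => exact fun τ R hR s hs t ht => hR.circ (.inl rfl) hs ht
    | times => exact fun τ R hR s hs t ht => hR.circ (.inr rfl) hs ht
    | flatten => exact fun τ R hR s hs => hR.flatten hs
    | lift => exact fun τ R hR s hs => hR.lift hs
  | @lam V X Γ σ τ s _ ih =>
    intro θ ξ γ h hγ
    rw [TyModel.tyEval_arrow]
    intro t ht
    refine (isCandidate_tyEval τ h).expand (.beta _ _ _) ?_
    rw [Term.inst_subst_up]
    refine ih h fun x => ?_
    cases x with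
    | none => exact ht
    | some x => exact hγ x
  | app _ _ ihs iht =>
    intro θ ξ γ h hγ
    have h' := ihs h hγ
    rw [TyModel.tyEval_arrow] at h'
    exact h' _ (iht h hγ)
  | @tlam V X Γ κ σ s _ ih =>
    intro θ ξ γ h hγ
    rw [TyModel.tyEval_all]
    intro τ a ha
    refine (isCandidate_tyEval σ (valid_cons h ha)).expand (.tbeta _ _) ?_
    rw [Term.tinst_subst_tsubst_up]
    refine ih (valid_cons h ha) fun x => ?_
    rw [TyModel.tyEval_weaken]
    exact hγ x
  | tapp τ _ ih =>
    intro θ ξ γ h hγ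
    have h' := ih h hγ
    rw [TyModel.tyEval_all] at h'
    rw [TyModel.tyEval_inst]
    exact h' _ _ (valid_eval τ h)

theorem ClosedHasType.evaluates {s : ClosedTerm} (h : ClosedHasType s Ty.nat) : Evaluates s := by
  have h := HasType.reducible h (θ := fun _ x => x.elim) (ξ := fun _ x => x.elim)
    (γ := fun x => x.elim) (fun _ x => x.elim) (fun x => x.elim)
  have e₁ : (fun κ (x : NoVar κ) => (x.elim : TyCon NoVar κ)) = fun _ x => .var x :=
    funext fun _ => funext fun x => x.elim
  have e₂ : (fun x : Empty => (x.elim : ClosedTerm)) = .var := funext fun x => x.elim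
  rw [e₁, e₂, Term.tsubst_var, Term.subst_var] at h
  exact h

theorem ClosedHasType.exists_nf_eq_num {s : ClosedTerm} (h : ClosedHasType s Ty.nat) :
    ∃ n, s.nf = .num n := by
  have h' : ∃ t, Relation.ReflTransGen Term.Step s t ∧ t.IsNormal := by
    obtain ⟨n, hn⟩ := h.evaluates
    exact ⟨_, hn, fun t h => by cases h⟩
  have hs := h'.choose_spec
  rw [Term.nf, dif_pos h']
  exact (((HasType.steps hs.1 h).closedValue (fun _ => inferInstance) inferInstance hs.2)).eq_num

/-! ### Closed inhabitants in normal form -/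

theorem Term.isNormal_num {V : Kind → Type} {X : Type} (n : ℕ) :
    (Term.num (V := V) (X := X) n).IsNormal := fun t h => by cases h

/-- At a neutral type none of the rules for `lift` applies, even up to conversion. -/
theorem TyCon.NormalForm.isNormal_lift {V : Kind → Type} {X : Type} {φ : TyCon V .star}
    (hφ : NormalForm true φ) : (Term.lift (X := X) (Ty.mk φ) (.num 0)).IsNormal := by
  intro t h
  generalize eσ : Ty.mk φ = σ at h
  generalize es : Term.lift (X := X) σ (.num 0) = s at h
  cases h with
  | app_left u h =>
    cases es
    cases h with
    | tapp _ h => cases h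
  | app_right u h =>
    cases es
    cases h
  | lift_nat =>
    cases es
    cases Ty.eq_nat_of_mk_eq hφ.isNormal eσ
    cases hφ
  | lift_arrow =>
    cases es
    obtain ⟨a, b, rfl⟩ := Ty.exists_eq_arrow hφ.isNormal eσ
    cases hφ
  | lift_all =>
    cases es
    obtain ⟨a, rfl⟩ := Ty.exists_eq_all hφ.isNormal eσ
    cases hφ
  | _ => cases es

/-- Every type has an inhabitant in normal form without free term variables of its own: `0` under as
many abstractions as the normal type prescribes, lifted if the type they end in is neutral. -/
theorem TyCon.NormalForm.exists_isNormal_hasType : ∀ {V : Kind → Type} {σ : TyCon V .star},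
    NormalForm false σ → ∀ {X : Type} (Γ : X → Ty V .star),
    ∃ s, HasType Γ s (Ty.mk σ) ∧ s.IsNormal
  | _, _, .neutral h, _, _ => ⟨_, .lift (.num 0), h.isNormal_lift⟩
  | _, _, .nat, _, _ => ⟨_, .num 0, Term.isNormal_num 0⟩
  | _, .arrow a b, .arrow _ hb, _, Γ => by
    obtain ⟨s, hs, hs'⟩ := exists_isNormal_hasType hb (extEnv Γ (Ty.mk a))
    refine ⟨.lam (Ty.mk a) s, HasType.lam (τ := Ty.mk b) hs, fun t h => ?_⟩
    cases h with
    | lam _ h => exact hs' _ h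
  | _, .all κ a, .all ha, _, Γ => by
    obtain ⟨s, hs, hs'⟩ := exists_isNormal_hasType ha fun x => (Γ x).weaken κ
    refine ⟨.tlam κ s, HasType.tlam (σ := Ty.mk a) hs, fun t h => ?_⟩
    cases h with
    | tlam h => exact hs' _ h

theorem exists_isFinal {σ : TyCon NoVar .star} (hσ : σ.IsNormal) : ∃ q, IsFinal (Ty.mk σ) q :=
  hσ.normalForm.exists_isNormal_hasType _

/-! ### Comparison of closed terms -/

theorem CompareStep.mono {cmp : ℕ → ℕ → Prop}
    {S T : TyCon NoVar .star → ClosedTerm → ClosedTerm → Prop} (h : ∀ σ s t, S σ s t → T σ s t)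
    {σ : TyCon NoVar .star} {s t : ClosedTerm} (hst : CompareStep cmp S σ s t) :
    CompareStep cmp T σ s t := by
  rcases hst with h' | ⟨a, b, e, h'⟩ | ⟨κ, ρ, e, h'⟩
  · exact .inl h'
  · exact .inr (.inl ⟨a, b, e, fun q hq => h _ _ _ (h' q hq)⟩)
  · exact .inr (.inr ⟨κ, ρ, e, fun τ => h _ _ _ (h' τ)⟩)

theorem Compare.compareStep {cmp : ℕ → ℕ → Prop} {σ : TyCon NoVar .star} {s t : ClosedTerm}
    (h : Compare cmp σ s t) : CompareStep cmp (Compare cmp) σ s t := by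
  obtain ⟨S, hS, h⟩ := h
  exact (hS _ _ _ h).mono fun _ _ _ h => ⟨S, hS, h⟩

section Inversion

variable {cmp : ℕ → ℕ → Prop} {s t : ClosedTerm}

theorem Compare.nat_inv (h : Compare cmp .nat s t) :
    ∃ n m, s.nf = .num n ∧ t.nf = .num m ∧ cmp n m := by
  rcases h.compareStep with ⟨-, h⟩ | ⟨_, _, e, -⟩ | ⟨_, _, e, -⟩
  · exact h
  · cases e
  · cases e

theorem Compare.arrow_inv {σ τ : TyCon NoVar .star} (h : Compare cmp (.arrow σ τ) s t)
    {q : ClosedTerm} (hq : IsFinal (Ty.mk σ) q) : Compare cmp τ (.app s q) (.app t q) := by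
  rcases h.compareStep with ⟨e, -⟩ | ⟨_, _, e, h⟩ | ⟨_, _, e, -⟩
  · cases e
  · cases e; exact h q hq
  · cases e

theorem Compare.all_inv {κ : Kind} {ρ : TyCon (Ext NoVar κ) .star}
    (h : Compare cmp (.all κ ρ) s t) (τ : TyCon NoVar κ) :
    Compare cmp (Ty.nf (Ty.mk (ρ.inst τ))) (.tapp s (Ty.mk τ)) (.tapp t (Ty.mk τ)) := by
  rcases h.compareStep with ⟨e, -⟩ | ⟨_, _, e, -⟩ | ⟨_, _, e, h⟩
  · cases e
  · cases e
  · cases e; exact h τ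

end Inversion

theorem Compare.comp {cmp₁ cmp₂ cmp₃ : ℕ → ℕ → Prop}
    (hc : ∀ n m k, cmp₁ n m → cmp₂ m k → cmp₃ n k) {σ : TyCon NoVar .star} {s t u : ClosedTerm}
    (h₁ : Compare cmp₁ σ s t) (h₂ : Compare cmp₂ σ t u) : Compare cmp₃ σ s u := by
  refine ⟨fun σ s u => ∃ t, Compare cmp₁ σ s t ∧ Compare cmp₂ σ t u, ?_, t, h₁, h₂⟩
  rintro ρ a b ⟨c, h₁, h₂⟩
  rcases h₁.compareStep with ⟨rfl, n, m, hn, hm, hnm⟩ | ⟨σ, τ, rfl, h⟩ | ⟨κ, σ, rfl, h⟩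
  · obtain ⟨m', k, hm', hk, hmk⟩ := h₂.nat_inv
    cases hm.symm.trans hm'
    exact .inl ⟨rfl, n, k, hn, hk, hc _ _ _ hnm hmk⟩
  · exact .inr (.inl ⟨σ, τ, rfl, fun q hq => ⟨_, h q hq, h₂.arrow_inv hq⟩⟩)
  · exact .inr (.inr ⟨κ, σ, rfl, fun τ => ⟨_, h τ, h₂.all_inv τ⟩⟩)

theorem Compare.mono {cmp cmp' : ℕ → ℕ → Prop} (hc : ∀ n m, cmp n m → cmp' n m)
    {σ : TyCon NoVar .star} {s t : ClosedTerm} (h : Compare cmp σ s t) : Compare cmp' σ s t := by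
  refine ⟨Compare cmp, fun ρ a b h => ?_, h⟩
  rcases h.compareStep with ⟨e, n, m, hn, hm, hnm⟩ | h | h
  · exact .inl ⟨e, n, m, hn, hm, hc _ _ hnm⟩
  · exact .inr (.inl h)
  · exact .inr (.inr h)

/-- Reflexivity at closed types. This is where termination is used: a closed term of type `nat`
has a numeral as its normal form. -/
theorem Compare.refl {cmp : ℕ → ℕ → Prop} (hc : ∀ n, cmp n n) {σ : Ty NoVar .star}
    {s : ClosedTerm} (hs : ClosedHasType s σ) : Compare cmp σ.nf s s := by
  refine ⟨fun ρ a b => a = b ∧ ClosedHasType a (Ty.mk ρ) ∧ ρ.IsNormal, ?_, rfl,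
    σ.nf_spec.1.symm ▸ hs, σ.nf_spec.2⟩
  rintro ρ a _ ⟨rfl, ha, hρ⟩
  rcases hρ.normalForm.closed_cases (fun _ => inferInstance) with
    rfl | ⟨σ, τ, rfl⟩ | ⟨κ, σ, rfl⟩
  · obtain ⟨n, hn⟩ := ha.exists_nf_eq_num
    exact .inl ⟨rfl, n, n, hn, hn, hc n⟩
  · exact .inr (.inl ⟨σ, τ, rfl, fun q hq => ⟨rfl,
      HasType.app (σ := Ty.mk σ) (τ := Ty.mk τ) ha hq.1, fun _ h => hρ _ (.arrow_right _ h)⟩⟩)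
  · refine .inr (.inr ⟨κ, σ, rfl, fun τ => ⟨rfl, ?_, (Ty.nf_spec _).2⟩⟩)
    rw [(Ty.nf_spec _).1]
    exact HasType.tapp (σ := Ty.mk σ) τ ha

/-! ### Well-foundedness -/

/-- The value `0` at kind `*`, and constantly so at arrow kinds. -/
def zeroValue : (κ : Kind) → Sem ℕ κ
  | .star => (0 : ℕ)
  | .arr _ κ₂ => fun _ => zeroValue κ₂

/-- The value of a type in this model is the number of arguments after which a term of that type
becomes a term of type `nat`, when `χ_κ` is the argument at each quantifier. -/
def arityModel : TyModel ℕ where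
  nat := 0
  arrow _ b := b + 1
  all κ F := F (zeroValue κ) + 1

theorem arityModel_eval_chi : ∀ {κ : Kind} {V : Kind → Type} (ξ : ∀ κ', V κ' → Sem ℕ κ'),
    arityModel.eval ξ (TyCon.chi κ) = zeroValue κ
  | .star, _, _ => rfl
  | .arr _ _, _, _ => funext fun _ => arityModel_eval_chi _

/-- The number that a numeral stands for, and `0` for all other terms. -/
def Term.numValue {V : Kind → Type} {X : Type} : Term V X → ℕ
  | .sym (.num n) => n
  | _ => 0

/-- Comparison at a closed type is reflected by comparison of the numbers obtained by supplying
suitable arguments: a final inhabitant at each arrow and `χ_κ` at each quantifier. -/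
theorem exists_natValue (cmp : ℕ → ℕ → Prop) : ∀ (n : ℕ) {σ : TyCon NoVar .star}, σ.IsNormal →
    arityModel.eval (fun _ x => x.elim) σ = n →
    ∃ f : ClosedTerm → ℕ, ∀ s t, Compare cmp σ s t → cmp (f s) (f t) := by
  intro n
  induction n with
  | zero =>
    intro σ hσ hn
    rcases hσ.normalForm.closed_cases (fun _ => inferInstance) with
      rfl | ⟨σ, τ, rfl⟩ | ⟨κ, σ, rfl⟩
    · refine ⟨fun s => s.nf.numValue, fun s t h => ?_⟩
      obtain ⟨n, m, hn, hm, h⟩ := h.nat_inv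
      simp only [hn, hm]
      exact h
    · exact absurd hn (Nat.succ_ne_zero _)
    · exact absurd hn (Nat.succ_ne_zero _)
  | succ n ih =>
    intro σ hσ hn
    rcases hσ.normalForm.closed_cases (fun _ => inferInstance) with
      rfl | ⟨σ, τ, rfl⟩ | ⟨κ, σ, rfl⟩
    · exact absurd hn.symm (Nat.succ_ne_zero _)
    · obtain ⟨q, hq⟩ := exists_isFinal (σ := σ) fun _ h => hσ _ (.arrow_left _ h)
      obtain ⟨f, hf⟩ := ih (σ := τ) (fun _ h => hσ _ (.arrow_right _ h)) (Nat.succ.inj hn)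
      exact ⟨fun s => f (.app s q), fun s t h => hf _ _ (h.arrow_inv hq)⟩
    · obtain ⟨h₁, h₂⟩ := Ty.nf_spec (Ty.mk (σ.inst (TyCon.chi κ)))
      have e : arityModel.eval (fun _ x => x.elim) (Ty.nf (Ty.mk (σ.inst (TyCon.chi κ)))) = n := by
        have h := congrArg (arityModel.tyEval fun _ x => x.elim) h₁
        refine h.trans ((arityModel.eval_inst _ _ _).trans ?_)
        rw [arityModel_eval_chi]
        exact Nat.succ.inj hn
      obtain ⟨f, hf⟩ := ih h₂ e
      exact ⟨fun s => f (.tapp s (Ty.mk (TyCon.chi κ))), fun s t h => hf _ _ (h.all_inv _)⟩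

/-! ### Comparison of arbitrary terms -/

section Closures

variable {V : Kind → Type} {X : Type} {Γ : X → Ty V .star}

theorem Closure.onTerm_hasType (C : Closure Γ) {s : Term V X} {σ : Ty V .star}
    (h : HasType Γ s σ) : ClosedHasType (C.onTerm s) (C.onType σ) :=
  (h.tsubst C.tyMap).subst C.typed

/-- The closure that substitutes `χ_κ` for type constructor variables and `lift 0` for term
variables. -/
def zeroClosure (Γ : X → Ty V .star) : Closure Γ where
  tyMap κ _ := TyCon.chi κ
  tmMap x := Term.lift ((Γ x).subst fun κ _ => TyCon.chi κ) (.num 0)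
  typed _ := .lift (.num 0)

theorem CompareOpen.exists_natValue (Γ : X → Ty V .star) (σ : Ty V .star) (cmp : ℕ → ℕ → Prop) :
    ∃ f : Term V X → ℕ, ∀ s t, CompareOpen cmp Γ σ s t → cmp (f s) (f t) := by
  obtain ⟨f, hf⟩ := FOmega.exists_natValue cmp _ (Ty.nf_spec ((zeroClosure Γ).onType σ)).2 rfl
  exact ⟨fun s => f ((zeroClosure Γ).onTerm s), fun s t h => hf _ _ (h _)⟩

theorem CompareOpen.comp {cmp₁ cmp₂ cmp₃ : ℕ → ℕ → Prop}
    (hc : ∀ n m k, cmp₁ n m → cmp₂ m k → cmp₃ n k) {σ : Ty V .star} {s t u : Term V X}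
    (h₁ : CompareOpen cmp₁ Γ σ s t) (h₂ : CompareOpen cmp₂ Γ σ t u) : CompareOpen cmp₃ Γ σ s u :=
  fun C => (h₁ C).comp hc (h₂ C)

theorem CompareOpen.mono {cmp cmp' : ℕ → ℕ → Prop} (hc : ∀ n m, cmp n m → cmp' n m)
    {σ : Ty V .star} {s t : Term V X} (h : CompareOpen cmp Γ σ s t) : CompareOpen cmp' Γ σ s t :=
  fun C => (h C).mono hc

theorem CompareOpen.refl {cmp : ℕ → ℕ → Prop} (hc : ∀ n, cmp n n) {σ : Ty V .star}
    {s : Term V X} (hs : HasType Γ s σ) : CompareOpen cmp Γ σ s s :=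
  fun C => Compare.refl hc (C.onTerm_hasType hs)

end Closures

theorem isOrderingPair_succAt {V : Kind → Type} {X : Type} (Γ : X → Ty V .star)
    (σ : Ty V .star) : IsOrderingPair (SuccAt Γ σ) (SucceqAt Γ σ) where
  gt_wf := by
    obtain ⟨f, hf⟩ := CompareOpen.exists_natValue Γ σ fun n m => n > m
    exact Subrelation.wf (h₁ := fun {a b} h => hf b.1 a.1 h)
      (InvImage.wf (fun a : ITermOf Γ σ => f a.1) wellFounded_lt)
  gt_trans _ _ _ := CompareOpen.comp fun _ _ _ h₁ h₂ => h₂.trans h₁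
  ge_trans _ _ _ := CompareOpen.comp fun _ _ _ h₁ h₂ => h₂.trans h₁
  ge_refl a := CompareOpen.refl (cmp := fun n m => n ≥ m) (fun _ => le_rfl) a.2
  gt_ge _ _ _ := CompareOpen.comp fun n m k (h₁ : n > m) (h₂ : m ≥ k) => lt_of_le_of_lt h₂ h₁
  ge_gt _ _ _ := CompareOpen.comp fun n m k (h₁ : n ≥ m) (h₂ : m > k) => lt_of_lt_of_le h₂ h₁
  gt_sub_ge _ _ := CompareOpen.mono fun _ _ h => le_of_lt h

/-- Types are unique, so the relations without a type index inherit the properties of the relations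
at the individual types. -/
theorem isOrderingPair_succ {V : Kind → Type} {X : Type} (Γ : X → Ty V .star) :
    IsOrderingPair (Succ Γ) (Succeq Γ) where
  gt_wf := by
    -- A term is measured at its unique type.
    choose f hf using fun σ => CompareOpen.exists_natValue Γ σ fun n m => n > m
    refine Subrelation.wf (h₁ := fun {a b} h => ?_)
      (InvImage.wf (fun a : ITerm Γ => f a.2.choose a.1) wellFounded_lt)
    obtain ⟨σ, hb, ha, h⟩ := h
    have h := hf σ _ _ h
    change f a.2.choose a.1 < f b.2.choose b.1
    rwa [a.2.choose_spec.unique ha, b.2.choose_spec.unique hb]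
  gt_trans := by
    rintro a b c ⟨σ, ha, hb, h₁⟩ ⟨τ, hb', hc, h₂⟩
    cases hb.unique hb'
    exact ⟨σ, ha, hc, (isOrderingPair_succAt Γ σ).gt_trans _ _ _ h₁ h₂⟩
  ge_trans := by
    rintro a b c ⟨σ, ha, hb, h₁⟩ ⟨τ, hb', hc, h₂⟩
    cases hb.unique hb'
    exact ⟨σ, ha, hc, (isOrderingPair_succAt Γ σ).ge_trans _ _ _ h₁ h₂⟩
  ge_refl := by
    rintro ⟨a, σ, ha⟩
    exact ⟨σ, ha, ha, (isOrderingPair_succAt Γ σ).ge_refl _⟩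
  gt_ge := by
    rintro a b c ⟨σ, ha, hb, h₁⟩ ⟨τ, hb', hc, h₂⟩
    cases hb.unique hb'
    exact ⟨σ, ha, hc, (isOrderingPair_succAt Γ σ).gt_ge _ _ _ h₁ h₂⟩
  ge_gt := by
    rintro a b c ⟨σ, ha, hb, h₁⟩ ⟨τ, hb', hc, h₂⟩
    cases hb.unique hb'
    exact ⟨σ, ha, hc, (isOrderingPair_succAt Γ σ).ge_gt _ _ _ h₁ h₂⟩
  gt_sub_ge := by
    rintro a b ⟨σ, ha, hb, h⟩
    exact ⟨σ, ha, hb, (isOrderingPair_succAt Γ σ).gt_sub_ge _ _ h⟩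

end FOmega

theorem mainTheorem4 (V : FOmega.Kind → Type) (X : Type) (Γ : X → FOmega.Ty V FOmega.Kind.star) :
    (∀ σ : FOmega.Ty V FOmega.Kind.star,
      FOmega.IsOrderingPair (FOmega.SuccAt Γ σ) (FOmega.SucceqAt Γ σ)) ∧
    FOmega.IsOrderingPair (FOmega.Succ Γ) (FOmega.Succeq Γ) :=
  ⟨FOmega.isOrderingPair_succAt Γ, FOmega.isOrderingPair_succ Γ⟩
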